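/- Let $m\ge 1$ be an integer. For integers $n,k\ge 0$ let $$\mathcal C(n,k;s)=\sum_{(p_1,p_2)\in\mathbb Z^2\setminus\{(0,0)\}}\frac{\cos^n(k\,\theta_{p_1,p_2})}{(p_1^2+p_2^2)^s},\qquad \theta_{p_1,p_2}=\arg(p_1+\mathrm i p_2),$$ for $\operatorname{Re}s>1$, continued meromorphically to $s\in\mathbb C$, and put $$\mathcal F_{2m}(s)=\frac{\Gamma(1-s+2m)\,\Gamma(s)}{\Gamma(1-s)\,\Gamma(s+2m)},\qquad \widetilde{\mathcal C}(2,2m;s),\ \widetilde{\mathcal S}(2,2m;s)=\frac{\Gamma(s)}{2\pi^s\sqrt{\mathcal F_{2m}(s)}}\,\bigl[\mathcal C(0,1;s)\pm\mathcal C(1,4m;s)\bigr]$$ (with $+$ for $\widetilde{\mathcal C}$ and $-$ for $\widetilde{\mathcal S}$), and $$\Delta_3(2,2m;s)=\widetilde{\mathcal C}(2,2m;s)^2-\widetilde{\mathcal S}(2,2m;s)^2=\frac{\Gamma(s)^2}{\pi^{2s}\mathcal F_{2m}(s)}\,\mathcal C(0,1;s)\,\mathcal C(1,4m;s),$$ a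 meromorphic function on $\mathbb C$. Theorem 5.6. Assume that the Riemann hypothesis holds for $\Delta_3(2,2m;s)$, that is, every zero $s$ of the meromorphic function $\Delta_3(2,2m;\cdot)$ satisfies $\operatorname{Re}s=\tfrac12$. Let $\tfrac12+\mathrm i t_0$ and $\tfrac12+\mathrm i t_1$, with $t_0<t_1$ real, be two successive zeros of $\Delta_3(2,2m;s)$ on the critical line, so that $\Delta_3(2,2m;\tfrac12+\mathrm i t)\ne0$ for $t_0<t<t_1$. Then there is exactly one $t\in(t_0,t_1)$ such that $$\frac{\partial}{\partial\sigma}\arg\Delta_3(2,2m;\sigma+\mathrm i t)\Big|_{\sigma=1/2}=0,$$ where $\arg\Delta_3$ denotes any continuous branch of the argument near $\tfrac12+\mathrm i t$ (the derivative does not depend on the branch). -/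

import Mathlib

namespace AngularLattice

/-- The angular lattice sum `∑' cos^n(m θ_p) / (p₁² + p₂²)^s` over the nonzero points `p` of `ℤ × ℤ`,
where `θ_p = arg (p₁ + i p₂)`. It converges absolutely for `1 < Re s`. -/
noncomputable def latticeSeries (n m : ℕ) (s : ℂ) : ℂ :=
  ∑' p : {p : ℤ × ℤ // p ≠ 0},
    ((Real.cos (m * Complex.arg ((p.1.1 : ℂ) + (p.1.2 : ℂ) * Complex.I)) ^ n : ℝ) : ℂ) /
      ((p.1.1 : ℂ) ^ 2 + (p.1.2 : ℂ) ^ 2) ^ s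

/-- `g` is meromorphic on the whole plane, agrees with `f` on the half-plane `1 < Re s`, and is
normalized: its value is the analytic one wherever the singularity is removable, and `0` at poles. -/
def IsContinuation (f g : ℂ → ℂ) : Prop :=
  MeromorphicNFOn g Set.univ ∧ ∀ s : ℂ, 1 < s.re → g s = f s

/-- There is at most one continuation. -/
theorem IsContinuation.unique {f g₁ g₂ : ℂ → ℂ} (h₁ : IsContinuation f g₁)
    (h₂ : IsContinuation f g₂) : g₁ = g₂ := by
  have hd : MeromorphicOn (g₁ - g₂) Set.univ := h₁.1.meromorphicOn.sub h₂.1.meromorphicOn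
  have h2 : meromorphicOrderAt (g₁ - g₂) 2 = ⊤ := by
    rw [meromorphicOrderAt_eq_top_iff]
    refine Filter.Eventually.filter_mono nhdsWithin_le_nhds ?_
    filter_upwards [(isOpen_lt continuous_const Complex.continuous_re).mem_nhds
      (show (1 : ℝ) < (2 : ℂ).re by norm_num)] with z hz
    simp [h₁.2 z hz, h₂.2 z hz]
  funext s
  have hs : meromorphicOrderAt (g₁ - g₂) s = ⊤ := by
    by_contra h
    exact hd.meromorphicOrderAt_ne_top_of_isPreconnected isPreconnected_univ
      (Set.mem_univ s) (Set.mem_univ 2) h h2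
  rw [meromorphicOrderAt_eq_top_iff] at hs
  have he : g₁ =ᶠ[nhdsWithin s {s}ᶜ] g₂ := by
    filter_upwards [hs] with z hz
    exact sub_eq_zero.mp hz
  exact ((h₁.1 (Set.mem_univ s)).eventuallyEq_nhdsNE_iff_eventuallyEq_nhds
    (h₂.1 (Set.mem_univ s))).1 he |>.eq_of_nhds

/-- The (unique) meromorphic continuation to `ℂ` of a function given on `1 < Re s` (if it has none, which
does not happen for the lattice sums, the function itself). -/
noncomputable def continuation (f : ℂ → ℂ) : ℂ → ℂ :=
  open Classical in if h : ∃ g, IsContinuation f g then h.choose else f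

/-- The angular lattice sum `C(n, m; s)`, continued to the complex plane. -/
noncomputable def latticeC (n m : ℕ) : ℂ → ℂ := continuation (latticeSeries n m)

/-- `F_{2m}(s) = Γ(1 - s + 2m) Γ(s) / (Γ(1 - s) Γ(s + 2m))`. -/
noncomputable def phaseFactor (m : ℕ) (s : ℂ) : ℂ :=
  (Complex.Gamma (1 - s + 2 * m) * Complex.Gamma s) /
    (Complex.Gamma (1 - s) * Complex.Gamma (s + 2 * m))

/-- The rescaled sum `C̃(2, 2m; s)`. -/
noncomputable def rescaledC (m : ℕ) (s : ℂ) : ℂ :=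
  Complex.Gamma s / (2 * (Real.pi : ℂ) ^ s * phaseFactor m s ^ (1 / 2 : ℂ)) *
    (latticeC 0 1 s + latticeC 1 (4 * m) s)

/-- The rescaled sum `S̃(2, 2m; s)`. -/
noncomputable def rescaledS (m : ℕ) (s : ℂ) : ℂ :=
  Complex.Gamma s / (2 * (Real.pi : ℂ) ^ s * phaseFactor m s ^ (1 / 2 : ℂ)) *
    (latticeC 0 1 s - latticeC 1 (4 * m) s)

/-- `Δ₃(2, 2m; s) = C̃(2, 2m; s)² - S̃(2, 2m; s)²`. -/
noncomputable def Delta3 (m : ℕ) (s : ℂ) : ℂ := rescaledC m s ^ 2 - rescaledS m s ^ 2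

/-- The closed form of `Δ₃`, in which the square roots have disappeared. -/
theorem Delta3_eq (m : ℕ) (s : ℂ) :
    Delta3 m s = Complex.Gamma s ^ 2 / ((Real.pi : ℂ) ^ (2 * s) * phaseFactor m s) *
      latticeC 0 1 s * latticeC 1 (4 * m) s := by
  have h1 : (phaseFactor m s ^ (1 / 2 : ℂ)) ^ 2 = phaseFactor m s := by
    rw [← Complex.cpow_nat_mul]; norm_num
  have h2 : (Real.pi : ℂ) ^ (2 * s) = ((Real.pi : ℂ) ^ s) ^ 2 := by
    rw [← Complex.cpow_nat_mul]; norm_num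
  rw [h2]
  unfold Delta3 rescaledC rescaledS
  generalize phaseFactor m s ^ (1 / 2 : ℂ) = r at h1 ⊢
  rw [← h1, ← mul_pow]
  simp only [div_eq_mul_inv, mul_inv, mul_pow, inv_pow]
  ring

/-- The Riemann hypothesis for a meromorphic function on `ℂ`: each of its zeros (points of positive
order) has real part `1/2`. For `Delta3` there are no trivial zeros to be set apart: the poles of the
Gamma factors absorb those of the lattice sums. -/
def RiemannHypothesisFor (f : ℂ → ℂ) : Prop :=
  ∀ s : ℂ, 0 < meromorphicOrderAt f s → s.re = 1 / 2

/-- `A` is a continuous branch of `arg f` on a neighbourhood of `s`, where `f` has no zero. -/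
def IsArgBranchNear (f : ℂ → ℂ) (s : ℂ) (A : ℂ → ℝ) : Prop :=
  ∀ᶠ z in nhds s, f z ≠ 0 ∧ ContinuousAt A z ∧
    f z = (‖f z‖ : ℂ) * Complex.exp ((A z : ℂ) * Complex.I)

/-- `∂ arg f / ∂σ` vanishes at `σ + i t`. Local continuous branches of `arg f` differ by constant
multiples of `2π`, so it does not matter which one is differentiated. -/
def IsZeroOfArgDeriv (f : ℂ → ℂ) (σ t : ℝ) : Prop :=
  ∃ A : ℂ → ℝ, IsArgBranchNear f ((σ : ℂ) + (t : ℂ) * Complex.I) A ∧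
    HasDerivAt (fun x : ℝ => A ((x : ℂ) + (t : ℂ) * Complex.I)) 0 σ

/-- The point `1/2 + i t` of the critical line. -/
noncomputable def critPoint (t : ℝ) : ℂ := ((1 / 2 : ℝ) : ℂ) + (t : ℂ) * Complex.I

end AngularLattice

/-!
On the critical line put `s = 1/2 + i t` and `w = t²`. The functional equations of the two completed
lattice sums turn the Gamma factors of `Δ₃` into a rational function (`Delta3_eq_gaussXi_div`), so
that `Δ₃ (s)` is the quotient of an entire function of order one, invariant under `s ↦ 1 - s`, by the
polynomial `s (s - 1) ∏ (i + 1 - s)`, `i < 2 m`. Under the Riemann hypothesis the entire function,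
read in the variable `w`, is an entire function `f (w)` of order at most `3/4` with nonnegative real
zeros (`exists_entire_of_riemannHypothesis`).

By the Cauchy–Riemann equations the `σ`-derivative of `arg Δ₃` is `-(d/dt) log |Δ₃ (1/2 + i t)|`.
Hence it vanishes somewhere between two zeros, by Rolle's theorem (`exists_im_logDeriv_eq_zero`).
For uniqueness, multiply by `t`: what results is the function of `w`
`-2 w Re (f' / f) + 2 e w / (1/4 + w) + ∑ w / ((i + 1/2)² + w)`
(`mul_im_logDeriv_Delta3`). A zero `c ≥ 0` of `f` contributes `-2 w / (w - c)` to the first term,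
which is nondecreasing in `w` away from `c`, and a pole contributes `w / (a² + w)`, which is strictly
increasing. So on the squares of an interval free of zeros the sum is strictly increasing
(`strictMonoOn_radialArgDeriv`) and vanishes at most once. It always vanishes at `w = 0`, which
settles the interval around `t = 0`. No bound for the number of zeros is needed.

The sum over zeros is never formed. Instead `f` is divided by its Blaschke product in a large disc:
each Blaschke factor still contributes with the right sign, and the logarithmic derivative of the
zero-free quotient is small by the Borel–Carathéodory inequality, because the order of `f` is less
than one (`re_deriv_mul_logDeriv_nonpos`).

The functional equations come from the theta series of `ℤ[i]` with the harmonic polynomials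
`(p₁ + i p₂) ^ k`. Their generating function in `k` is the product of Jacobi theta functions
`θ (l, i x) θ (i l, i x)`, in whose functional equation the Gaussian factors cancel
(`gaussTheta_inv`).
-/

open Filter Topology Metric MeasureTheory

/-! ### Logarithmic derivatives of entire functions with nonnegative zeros -/

/-- A zero of an entire function can be divided out, with its full multiplicity, among the entire
functions. -/
theorem exists_eq_pow_sub_mul {f : ℂ → ℂ} (hf : Differentiable ℂ f)
    {a : ℂ} (ha : f a ≠ 0) (c : ℂ) :
    ∃ (n : ℕ) (g : ℂ → ℂ), Differentiable ℂ g ∧ g c ≠ 0 ∧ ∀ z, f z = (z - c) ^ n * g z := by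
  have hA : AnalyticOnNhd ℂ f Set.univ := fun z _ => hf.analyticAt z
  have hne : ¬ ∀ᶠ z in 𝓝 c, f z = 0 := fun h =>
    ha (hA.eqOn_zero_of_preconnected_of_eventuallyEq_zero isPreconnected_univ (Set.mem_univ c) h
      (Set.mem_univ a))
  obtain ⟨n, h, hh, hhc, hev⟩ :=
    ((hf.analyticAt c).exists_eventuallyEq_pow_smul_nonzero_iff).2 hne
  classical
  refine ⟨n, Function.update (fun z => f z / (z - c) ^ n) c (h c), fun z => ?_, by simpa, fun z => ?_⟩
  · rcases eq_or_ne z c with rfl | hz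
    · refine hh.differentiableAt.congr_of_eventuallyEq ?_
      filter_upwards [hev] with w hw
      rcases eq_or_ne w z with rfl | hwz
      · simp
      · rw [Function.update_of_ne hwz, hw, smul_eq_mul,
          mul_div_cancel_left₀ _ (pow_ne_zero _ (sub_ne_zero.2 hwz))]
    · refine DifferentiableAt.congr_of_eventuallyEq (f := fun z => f z / (z - c) ^ n) ?_ ?_
      · exact (hf z).div (by fun_prop) (pow_ne_zero _ (sub_ne_zero.2 hz))
      · filter_upwards [isOpen_ne.mem_nhds hz] with w hw
        exact Function.update_of_ne hw _ _
  · rcases eq_or_ne z c with rfl | hz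
    · rw [hev.self_of_nhds]; simp
    · rw [Function.update_of_ne hz, mul_div_cancel₀ _ (pow_ne_zero _ (sub_ne_zero.2 hz))]

theorem exists_eq_prod_pow_sub_mul {f : ℂ → ℂ} (hf : Differentiable ℂ f)
    {a : ℂ} (ha : f a ≠ 0) (Z : Finset ℂ) :
    ∃ (n : ℂ → ℕ) (g : ℂ → ℂ), Differentiable ℂ g ∧ (∀ c ∈ Z, g c ≠ 0) ∧
      ∀ z, f z = (∏ c ∈ Z, (z - c) ^ n c) * g z := by
  classical
  induction Z using Finset.induction_on with
  | empty => exact ⟨fun _ => 0, f, hf, by simp, by simp⟩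
  | insert b Z hb ih =>
    obtain ⟨n, g, hg, hgZ, hfg⟩ := ih
    have hga : g a ≠ 0 := fun h => ha (by rw [hfg, h, mul_zero])
    obtain ⟨k, g', hg', hgb, hgg⟩ := exists_eq_pow_sub_mul hg hga b
    refine ⟨Function.update n b k, g', hg', ?_, fun z => ?_⟩
    · intro c hc
      rcases Finset.mem_insert.1 hc with rfl | hc
      · exact hgb
      · intro h0
        exact hgZ c hc (by rw [hgg, h0, mul_zero])
    · rw [Finset.prod_insert hb, hfg, hgg]
      have : ∏ c ∈ Z, (z - c) ^ Function.update n b k c = ∏ c ∈ Z, (z - c) ^ n c :=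
        Finset.prod_congr rfl fun c hc => by
          rw [Function.update_of_ne (ne_of_mem_of_not_mem hc hb)]
      rw [this]; simp; ring

theorem finite_zeros_inter_closedBall {f : ℂ → ℂ} (hf : Differentiable ℂ f)
    {a : ℂ} (ha : f a ≠ 0) (R : ℝ) : ({z | f z = 0} ∩ closedBall 0 R).Finite := by
  by_contra hinf
  obtain ⟨c, -, hc⟩ := Set.Infinite.exists_accPt_of_subset_isCompact hinf
    (isCompact_closedBall (0 : ℂ) R) Set.inter_subset_right
  have hA : AnalyticOnNhd ℂ f Set.univ := fun z _ => hf.analyticAt z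
  refine ha (hA.eqOn_zero_of_preconnected_of_frequently_eq_zero isPreconnected_univ
    (Set.mem_univ c) ?_ (Set.mem_univ a))
  exact (accPt_iff_frequently_nhdsNE.1 hc).mono fun z hz => hz.1

/-- A logarithmic form of the Borel–Carathéodory inequality: a zero-free function on the disc of
radius `r` about `x` which is at most `exp A` times its central value has a logarithmic derivative
of size `O(A / r)` at `x`, with derivative of size `O(A / r ^ 2)`. -/
theorem norm_logDeriv_le_of_norm_le_exp {G : ℂ → ℂ} {x : ℂ} {r A : ℝ} (hr : 0 < r) (hA : 0 < A)
    (hG : Differentiable ℂ G) (h0 : ∀ z ∈ ball x r, G z ≠ 0)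
    (hle : ∀ z ∈ ball x r, ‖G z‖ ≤ Real.exp A * ‖G x‖) :
    ‖logDeriv G x‖ ≤ 4 * A / r ∧ ‖deriv (logDeriv G) x‖ ≤ 16 * A / r ^ 2 := by
  have hxr : x ∈ ball x r := mem_ball_self hr
  have hG' : Differentiable ℂ (deriv G) := hG.deriv
  have hld : DifferentiableOn ℂ (logDeriv G) (ball x r) := fun z hz =>
    ((hG' z).div (hG z) (h0 z hz)).differentiableWithinAt
  obtain ⟨h, hx0, hh⟩ := (hld.isExactOn_ball).with_val_at x 0
  have hhd : DifferentiableOn ℂ h (ball x r) := fun z hz =>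
    (hh z hz).differentiableAt.differentiableWithinAt
  -- `G = G x * exp h` on the disc, since the quotient has vanishing derivative
  have hexp : ∀ z ∈ ball x r, G z = G x * Complex.exp (h z) := by
    have hconst : ∀ z ∈ ball x r, G z * Complex.exp (-h z) = G x := by
      intro z hz
      have hd : ∀ w ∈ ball x r, HasDerivWithinAt (fun z => G z * Complex.exp (-h z)) 0
          (ball x r) w := by
        intro w hw
        have h1 := ((hG w).hasDerivAt.mul ((hh w hw).neg.cexp)).hasDerivWithinAt (s := ball x r)
        refine h1.congr_deriv ?_
        have := h0 w hw
        rw [logDeriv_apply, Pi.neg_apply]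
        field_simp
        ring
      have := (convex_ball x r).is_const_of_fderivWithin_eq_zero (𝕜 := ℂ)
        (f := fun z => G z * Complex.exp (-h z))
        (fun w hw => (hd w hw).differentiableWithinAt)
        (fun w hw => by
          have h2 := (hd w hw).hasFDerivWithinAt.fderivWithin
            (isOpen_ball.uniqueDiffWithinAt hw)
          rw [h2]; ext; simp) hz hxr
      simpa [hx0] using this
    intro z hz
    rw [← hconst z hz, mul_assoc, ← Complex.exp_add]; simp
  have hre : ∀ z ∈ ball x r, (h z).re ≤ A := by
    intro z hz
    have h1 := hle z hz
    rw [hexp z hz, norm_mul, Complex.norm_exp, mul_comm] at h1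
    exact Real.exp_le_exp.1 (le_of_mul_le_mul_right h1 (norm_pos_iff.2 (h0 x hxr)))
  -- Borel–Carathéodory, recentred at `x`
  have hb : ∀ z ∈ closedBall x (r / 2), ‖h z‖ ≤ 2 * A := by
    intro z hz
    have hz' : ‖z - x‖ ≤ r / 2 := by simpa [dist_eq_norm] using hz
    have h1 := Complex.borelCaratheodory_zero (f := fun w => h (x + w)) (R := r) (z := z - x) hA
      (hhd.comp (by fun_prop) fun w hw => by simpa using hw)
      (fun w hw => hre _ (by simpa using hw)) hr (by
        rw [mem_ball_zero_iff]; linarith) (by simpa using hx0)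
    rw [add_sub_cancel] at h1
    refine h1.trans ?_
    rw [div_le_iff₀ (by linarith)]
    nlinarith
  have hsub : closedBall x (r / 2) ⊆ ball x r := closedBall_subset_ball (by linarith)
  have hcl : DiffContOnCl ℂ h (ball x (r / 2)) :=
    (hhd.mono ((closure_ball_subset_closedBall).trans hsub)).diffContOnCl
  have hev : deriv h =ᶠ[𝓝 x] logDeriv G := by
    filter_upwards [isOpen_ball.mem_nhds hxr] with z hz using (hh z hz).deriv
  have e1 := Complex.norm_iteratedDeriv_le_of_forall_mem_sphere_norm_le 1 (half_pos hr) hcl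
    fun z hz => hb z (sphere_subset_closedBall hz)
  have e2 := Complex.norm_iteratedDeriv_le_of_forall_mem_sphere_norm_le 2 (half_pos hr) hcl
    fun z hz => hb z (sphere_subset_closedBall hz)
  rw [iteratedDeriv_one, hev.eq_of_nhds] at e1
  rw [iteratedDeriv_succ, iteratedDeriv_one, hev.deriv_eq] at e2
  refine ⟨e1.trans (le_of_eq ?_), e2.trans (le_of_eq ?_)⟩
  · simp; field_simp; ring
  · simp; field_simp; ring

/-- For a real point `c`, the reflection of `c` in the circle of radius `R` gives the factor
`(R ^ 2 - c z) / R`, which has the modulus of `z - c` on that circle. -/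
theorem norm_sq_sub_ofReal_mul_div_eq {R c : ℝ} (hR : 0 < R) {z : ℂ} (hz : ‖z‖ = R) :
    ‖((R : ℂ) ^ 2 - c * z) / R‖ = ‖z - c‖ := by
  have h1 : (R : ℂ) ^ 2 - c * z = z * (starRingEnd ℂ) (z - c) := by
    rw [map_sub, Complex.conj_ofReal, mul_sub, Complex.mul_conj, Complex.normSq_eq_norm_sq, hz]
    push_cast; ring
  rw [h1, norm_div, norm_mul, Complex.norm_conj, hz, Complex.norm_real, Real.norm_of_nonneg hR.le,
    mul_div_cancel_left₀ _ hR.ne']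

/-- The Blaschke quotient in a disc of radius `R`: the zeros of `f` in the disc are exchanged for
their reflections in the circle. The resulting function is zero-free in the disc, has the modulus
of `f` on the circle, and a larger modulus inside. -/
theorem exists_reflect_zeros {f : ℂ → ℂ} (hf : Differentiable ℂ f)
    (hz : ∀ z, f z = 0 → 0 ≤ z.re ∧ z.im = 0) {x R : ℝ} (hx : |x| < R) (hfx : f x ≠ 0) :
    ∃ (Z : Finset ℝ) (n : ℝ → ℕ) (G : ℂ → ℂ), Differentiable ℂ G ∧
      (∀ c ∈ Z, 0 ≤ c ∧ c < R ∧ f c = 0) ∧ (∀ z ∈ ball (0 : ℂ) R, G z ≠ 0) ∧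
      (∀ z, f z * ∏ c ∈ Z, (((R : ℂ) ^ 2 - c * z) / R) ^ n c =
        G z * ∏ c ∈ Z, (z - c) ^ n c) := by
  classical
  have hR : 0 < R := (abs_nonneg x).trans_lt hx
  have hfin := (finite_zeros_inter_closedBall hf hfx R).subset
    (Set.inter_subset_inter_right {z | f z = 0} ball_subset_closedBall)
  obtain ⟨n, g, hg, hgZ, hfg⟩ := exists_eq_prod_pow_sub_mul hf hfx hfin.toFinset
  have hreal : ∀ c ∈ hfin.toFinset, ((c.re : ℝ) : ℂ) = c := fun c hc => by
    have := (hz c ((hfin.mem_toFinset.1 hc).1)).2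
    apply Complex.ext <;> simp [this]
  have hinj : Set.InjOn Complex.re (hfin.toFinset : Set ℂ) := fun c hc d hd hcd => by
    rw [← hreal c hc, ← hreal d hd, hcd]
  have hmem : ∀ c ∈ hfin.toFinset.image Complex.re, 0 ≤ c ∧ c < R ∧ f c = 0 := by
    intro c hc
    obtain ⟨d, hd, rfl⟩ := Finset.mem_image.1 hc
    rw [hreal d hd]
    have h2 := hfin.mem_toFinset.1 hd
    refine ⟨(hz d h2.1).1, (Complex.re_le_norm d).trans_lt (by simpa using h2.2), h2.1⟩
  refine ⟨hfin.toFinset.image Complex.re, fun c => n c,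
    fun z => g z * ∏ c ∈ hfin.toFinset.image Complex.re, (((R : ℂ) ^ 2 - c * z) / R) ^ n c,
    ?_, hmem, ?_, ?_⟩
  · refine hg.mul ?_
    fun_prop
  · intro z hzR
    refine mul_ne_zero (fun h0 => ?_) (Finset.prod_ne_zero_iff.2 fun c hc => pow_ne_zero _ ?_)
    · have hfz : f z = 0 := by rw [hfg, h0, mul_zero]
      exact hgZ z (hfin.mem_toFinset.2 ⟨hfz, hzR⟩) h0
    · have h1 := hmem c hc
      refine div_ne_zero (sub_ne_zero.2 fun h => ?_) (by exact_mod_cast hR.ne')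
      have h2 := congrArg norm h
      rw [norm_mul, norm_pow, Complex.norm_real, Complex.norm_real, Real.norm_of_nonneg hR.le,
        Real.norm_of_nonneg h1.1] at h2
      have h3 : ‖z‖ < R := by simpa using hzR
      nlinarith [norm_nonneg z]
  · intro z
    have hprod : ∏ c ∈ hfin.toFinset.image Complex.re, (z - (c : ℂ)) ^ n c =
        ∏ c ∈ hfin.toFinset, (z - c) ^ n c := by
      rw [Finset.prod_image hinj]
      exact Finset.prod_congr rfl fun c hc => by rw [hreal c hc]
    rw [hfg, hprod]
    ring

/-- Each Blaschke factor contributes a nonpositive amount to the derivative of `z * f' / f` at a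
real point inside the circle. -/
theorem blaschke_term_nonpos {R x c : ℝ} (hx : |x| < R) (hc : 0 ≤ c) (hcR : c < R) (hxc : x ≠ c) :
    c * R ^ 2 / (R ^ 2 - c * x) ^ 2 - c / (x - c) ^ 2 ≤ 0 := by
  have hx' := abs_lt.1 hx
  have h1 : 0 < R ^ 2 - c * x := by nlinarith
  have h2 : 0 < (x - c) ^ 2 := by positivity [sub_ne_zero.2 hxc]
  have h3 : R ^ 2 * (x - c) ^ 2 ≤ (R ^ 2 - c * x) ^ 2 := by
    have : (R ^ 2 - c * x) ^ 2 - R ^ 2 * (x - c) ^ 2 = (R ^ 2 - c ^ 2) * (R ^ 2 - x ^ 2) := by ring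
    have h4 : 0 ≤ R ^ 2 - c ^ 2 := by nlinarith
    have h5 : 0 ≤ R ^ 2 - x ^ 2 := by nlinarith
    nlinarith [mul_nonneg h4 h5]
  rw [sub_nonpos, div_le_div_iff₀ (by positivity) h2]
  nlinarith [mul_le_mul_of_nonneg_left h3 hc]

/-- The derivative of `z * f' / f` at `x` for a quotient of the shape produced by
`exists_reflect_zeros`. -/
theorem logDeriv_add_mul_deriv_logDeriv_eq {f G : ℂ → ℂ} (hf : Differentiable ℂ f)
    (hG : Differentiable ℂ G) {x R : ℝ} {Z : Finset ℝ} {n : ℝ → ℕ} (hx : |x| < R)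
    (hZ : ∀ c ∈ Z, 0 ≤ c ∧ c < R ∧ x ≠ c) (hfx : f x ≠ 0) (hGx : G x ≠ 0)
    (h : ∀ z, f z * ∏ c ∈ Z, (((R : ℂ) ^ 2 - c * z) / R) ^ n c = G z * ∏ c ∈ Z, (z - c) ^ n c) :
    logDeriv f x + x * deriv (logDeriv f) x = logDeriv G x + x * deriv (logDeriv G) x +
      ((∑ c ∈ Z, n c * (c * R ^ 2 / (R ^ 2 - c * x) ^ 2 - c / (x - c) ^ 2) : ℝ) : ℂ) := by
  have hR : 0 < R := (abs_nonneg x).trans_lt hx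
  have hRc : (R : ℂ) ≠ 0 := by exact_mod_cast hR.ne'
  have hx' := abs_lt.1 hx
  have n1 : ∀ c ∈ Z, (x : ℂ) - c ≠ 0 := fun c hc => by
    exact_mod_cast sub_ne_zero.2 (hZ c hc).2.2
  have n2 : ∀ c ∈ Z, (R : ℂ) ^ 2 - c * x ≠ 0 := fun c hc => by
    have h1 := hZ c hc
    have : R ^ 2 - c * x ≠ 0 := by nlinarith
    exact_mod_cast this
  -- the identity of logarithmic derivatives near `x`
  have key : logDeriv f =ᶠ[𝓝 (x : ℂ)] logDeriv G + fun z : ℂ =>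
      ∑ c ∈ Z, (n c : ℂ) * (1 / (z - c) + c / ((R : ℂ) ^ 2 - c * z)) := by
    have e1 : ∀ᶠ z in 𝓝 (x : ℂ), f z ≠ 0 := (hf x).continuousAt.eventually_ne hfx
    have e2 : ∀ᶠ z in 𝓝 (x : ℂ), G z ≠ 0 := (hG x).continuousAt.eventually_ne hGx
    have e3 : ∀ᶠ z : ℂ in 𝓝 (x : ℂ), ∀ c ∈ Z, z - c ≠ 0 :=
      (Filter.eventually_all_finset Z).2 fun c hc =>
        (by fun_prop : ContinuousAt (fun z : ℂ => z - c) (x : ℂ)).eventually_ne (n1 c hc)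
    have e4 : ∀ᶠ z : ℂ in 𝓝 (x : ℂ), ∀ c ∈ Z, (R : ℂ) ^ 2 - c * z ≠ 0 :=
      (Filter.eventually_all_finset Z).2 fun c hc =>
        (by fun_prop : ContinuousAt (fun z : ℂ => (R : ℂ) ^ 2 - c * z) (x : ℂ)).eventually_ne (n2 c hc)
    filter_upwards [e1, e2, e3, e4] with z h1 h2 h3 h4
    have hl := congrArg (fun F => logDeriv F z) (funext h)
    have p1 : ∀ c ∈ Z, ((((R : ℂ) ^ 2 - c * z) / R) ^ n c) ≠ 0 := fun c hc =>
      pow_ne_zero _ (div_ne_zero (h4 c hc) hRc)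
    have p2 : ∀ c ∈ Z, (z - c) ^ n c ≠ 0 := fun c hc => pow_ne_zero _ (h3 c hc)
    have d1 : ∀ c : ℝ, logDeriv (fun z : ℂ => (((R : ℂ) ^ 2 - c * z) / R) ^ n c) z =
        n c * (-c / ((R : ℂ) ^ 2 - c * z)) := fun c => by
      rw [logDeriv_fun_pow (by fun_prop), logDeriv_apply]
      have hd : HasDerivAt (fun z : ℂ => ((R : ℂ) ^ 2 - c * z) / R) (-(c * 1) / R) z :=
        (((hasDerivAt_id z).const_mul (c : ℂ)).const_sub _).div_const _
      rw [hd.deriv]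
      field_simp
    have d2 : ∀ c : ℝ, logDeriv (fun z : ℂ => (z - c) ^ n c) z = n c * (1 / (z - c)) := fun c => by
      rw [logDeriv_fun_pow (by fun_prop), logDeriv_apply]
      simp
    rw [logDeriv_mul (f := f) z h1 (Finset.prod_ne_zero_iff.2 p1) (hf z) (by fun_prop),
      logDeriv_mul (f := G) z h2 (Finset.prod_ne_zero_iff.2 p2) (hG z) (by fun_prop),
      logDeriv_prod p1 (fun c hc => by fun_prop),
      logDeriv_prod p2 (fun c hc => by fun_prop)] at hl
    simp only [d1, d2] at hl
    rw [Pi.add_apply, ← sub_eq_iff_eq_add.2 hl.symm]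
    rw [eq_comm, add_sub_assoc, ← Finset.sum_sub_distrib]
    congr 1
    refine Finset.sum_congr rfl fun c _ => ?_
    ring
  have hdG : DifferentiableAt ℂ (logDeriv G) x := (hG.deriv x).div (hG x) hGx
  have hdsum : HasDerivAt
      (fun z : ℂ => ∑ c ∈ Z, (n c : ℂ) * (1 / (z - c) + c / ((R : ℂ) ^ 2 - c * z)))
      (∑ c ∈ Z, (n c : ℂ) * (-1 / ((x : ℂ) - c) ^ 2 + c ^ 2 / ((R : ℂ) ^ 2 - c * x) ^ 2)) x := by
    refine HasDerivAt.fun_sum fun c hc => HasDerivAt.const_mul _ (HasDerivAt.add ?_ ?_)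
    · have := ((hasDerivAt_const (x : ℂ) (1 : ℂ)).div
        ((hasDerivAt_id (x : ℂ)).sub_const (c : ℂ)) (n1 c hc))
      refine this.congr_deriv ?_
      simp
    · have := ((hasDerivAt_const (x : ℂ) (c : ℂ)).div
        (((hasDerivAt_id (x : ℂ)).const_mul (c : ℂ)).const_sub ((R : ℂ) ^ 2)) (n2 c hc))
      refine this.congr_deriv ?_
      simp; ring
  rw [key.eq_of_nhds, key.deriv_eq, (hdG.hasDerivAt.add hdsum).deriv, Pi.add_apply]
  push_cast
  rw [mul_add, Finset.mul_sum, add_add_add_comm, ← Finset.sum_add_distrib]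
  congr 1
  refine Finset.sum_congr rfl fun c hc => ?_
  have h1 := n1 c hc
  have h2 := n2 c hc
  generalize hu : (R : ℂ) ^ 2 - c * x = u at h2 ⊢
  have hR2 : (R : ℂ) ^ 2 = u + c * x := by rw [← hu]; ring
  rw [hR2]
  field_simp
  ring

/-- A finite form of the monotonicity of `x * f' / f`, with the error controlled by the size of `f`
on a disc of radius `R`. -/
theorem re_deriv_mul_logDeriv_le {f : ℂ → ℂ} (hf : Differentiable ℂ f)
    (hz : ∀ z, f z = 0 → 0 ≤ z.re ∧ z.im = 0) {x R B : ℝ} (hx0 : 0 < x) (hx : x < R)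
    (hfx : f x ≠ 0) (hB : ∀ z ∈ closedBall (0 : ℂ) R, ‖f z‖ ≤ Real.exp B)
    (hA : Real.log ‖f x‖ < B) :
    (logDeriv f x + x * deriv (logDeriv f) x).re ≤
      4 * (B - Real.log ‖f x‖) / (R - x) + x * (16 * (B - Real.log ‖f x‖) / (R - x) ^ 2) := by
  have hR : 0 < R := hx0.trans hx
  have hRc : (R : ℂ) ≠ 0 := by exact_mod_cast hR.ne'
  have hxR : |x| < R := by rwa [abs_of_pos hx0]
  have hxb : (x : ℂ) ∈ ball (0 : ℂ) R := by simpa using hxR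
  obtain ⟨Z, n, G, hG, hZ, hG0, h⟩ := exists_reflect_zeros hf hz hxR hfx
  have hZ' : ∀ c ∈ Z, 0 ≤ c ∧ c < R ∧ x ≠ c := fun c hc =>
    ⟨(hZ c hc).1, (hZ c hc).2.1, fun h => hfx (h ▸ (hZ c hc).2.2)⟩
  -- on the circle `G` has the modulus of `f`
  have hsph : ∀ z ∈ frontier (ball (0 : ℂ) R), ‖G z‖ ≤ Real.exp B := by
    intro z hz'
    rw [frontier_ball _ hR.ne'] at hz'
    have hzR : ‖z‖ = R := by simpa using hz'
    have h1 := congrArg norm (h z)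
    rw [norm_mul, norm_mul, norm_prod, norm_prod] at h1
    have h2 : ∏ c ∈ Z, ‖(((R : ℂ) ^ 2 - c * z) / R) ^ n c‖ = ∏ c ∈ Z, ‖(z - c) ^ n c‖ :=
      Finset.prod_congr rfl fun c _ => by
        rw [norm_pow, norm_pow, norm_sq_sub_ofReal_mul_div_eq hR hzR]
    rw [h2] at h1
    have h3 : ∏ c ∈ Z, ‖(z - c) ^ n c‖ ≠ 0 := by
      refine Finset.prod_ne_zero_iff.2 fun c hc => ?_
      rw [norm_ne_zero_iff]
      refine pow_ne_zero _ (sub_ne_zero.2 fun hzc => ?_)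
      rw [hzc, Complex.norm_real, Real.norm_of_nonneg (hZ c hc).1] at hzR
      exact (hZ c hc).2.1.ne hzR
    rw [← mul_right_cancel₀ h3 h1]
    exact hB z (sphere_subset_closedBall hz')
  have hball : ∀ z ∈ ball (0 : ℂ) R, ‖G z‖ ≤ Real.exp B := fun z hz' =>
    Complex.norm_le_of_forall_mem_frontier_norm_le isBounded_ball hG.diffContOnCl hsph
      (subset_closure hz')
  -- at `x` it has at least the modulus of `f`
  have hGx : ‖f x‖ ≤ ‖G x‖ := by
    have h1 := congrArg norm (h x)
    rw [norm_mul, norm_mul, norm_prod, norm_prod] at h1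
    have h2 : ∏ c ∈ Z, ‖((x : ℂ) - c) ^ n c‖ ≤ ∏ c ∈ Z, ‖(((R : ℂ) ^ 2 - c * x) / R) ^ n c‖ := by
      refine Finset.prod_le_prod (fun _ _ => norm_nonneg _) fun c hc => ?_
      rw [norm_pow, norm_pow]
      refine pow_le_pow_left₀ (norm_nonneg _) ?_ _
      have e1 : ((R : ℂ) ^ 2 - c * x) / R = ((R ^ 2 - c * x) / R : ℝ) := by push_cast; rfl
      have e2 : (x : ℂ) - c = (x - c : ℝ) := by push_cast; rfl
      rw [e1, e2, Complex.norm_real, Complex.norm_real, Real.norm_eq_abs, Real.norm_eq_abs]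
      have := hZ' c hc
      refine le_trans ?_ (le_abs_self _)
      rw [le_div_iff₀ hR]
      rcases abs_cases (x - c) with ⟨h3, _⟩ | ⟨h3, _⟩ <;> rw [h3] <;> nlinarith
    have h3 : 0 < ∏ c ∈ Z, ‖((x : ℂ) - c) ^ n c‖ := by
      refine Finset.prod_pos fun c hc => norm_pos_iff.2 (pow_ne_zero _ (sub_ne_zero.2 ?_))
      exact_mod_cast (hZ' c hc).2.2
    refine le_of_mul_le_mul_right ?_ h3
    rw [← h1]
    exact mul_le_mul_of_nonneg_left h2 (norm_nonneg _)
  have hfpos : 0 < ‖f x‖ := norm_pos_iff.2 hfx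
  have hsub : ball (x : ℂ) (R - x) ⊆ ball 0 R := by
    refine ball_subset_ball' ?_
    simp [abs_of_pos hx0]
  have hmain := norm_logDeriv_le_of_norm_le_exp (G := G) (x := x) (sub_pos.2 hx) (sub_pos.2 hA) hG
    (fun z hz' => hG0 z (hsub hz')) (fun z hz' => by
      refine (hball z (hsub hz')).trans ?_
      rw [Real.exp_sub, Real.exp_log hfpos, div_mul_eq_mul_div, le_div_iff₀ hfpos]
      exact mul_le_mul_of_nonneg_left hGx (Real.exp_pos _).le)
  rw [logDeriv_add_mul_deriv_logDeriv_eq hf hG hxR hZ' hfx (hG0 _ hxb) h, Complex.add_re,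
    Complex.ofReal_re]
  have hneg : ∑ c ∈ Z, (n c : ℝ) * (c * R ^ 2 / (R ^ 2 - c * x) ^ 2 - c / (x - c) ^ 2) ≤ 0 :=
    Finset.sum_nonpos fun c hc => mul_nonpos_of_nonneg_of_nonpos (Nat.cast_nonneg _)
      (blaschke_term_nonpos hxR (hZ' c hc).1 (hZ' c hc).2.1 (hZ' c hc).2.2)
  have hre : (logDeriv G x + x * deriv (logDeriv G) x).re ≤
      ‖logDeriv G x‖ + x * ‖deriv (logDeriv G) x‖ := by
    refine (Complex.re_le_norm _).trans ((norm_add_le _ _).trans ?_)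
    rw [norm_mul, Complex.norm_real, Real.norm_of_nonneg hx0.le]
  have := mul_le_mul_of_nonneg_left hmain.2 hx0.le
  linarith [hmain.1]

/-- For an entire function of order less than one whose zeros are real and nonnegative, the
logarithmic derivative `x * f' / f` with respect to `log x` is nonincreasing on each interval of
the positive half-line without zeros. -/
theorem re_deriv_mul_logDeriv_nonpos {f : ℂ → ℂ} (hf : Differentiable ℂ f)
    (hz : ∀ z, f z = 0 → 0 ≤ z.re ∧ z.im = 0) {C ρ : ℝ} (hρ0 : 0 ≤ ρ) (hρ : ρ < 1)
    (hC : ∀ z, ‖f z‖ ≤ Real.exp (C * (1 + ‖z‖) ^ ρ)) {x : ℝ} (hx0 : 0 < x) (hfx : f x ≠ 0) :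
    (logDeriv f x + x * deriv (logDeriv f) x).re ≤ 0 := by
  set L := Real.log ‖f x‖
  set K := |C| + |L| + 1
  have hpow : ∀ R : ℝ, 0 ≤ R → 1 ≤ (1 + R) ^ ρ := fun R hR =>
    Real.one_le_rpow (by linarith) hρ0
  have hbound : ∀ᶠ R in atTop, (logDeriv f x + x * deriv (logDeriv f) x).re ≤
      4 * (K * (1 + R) ^ ρ - L) / (R - x) + x * (16 * (K * (1 + R) ^ ρ - L) / (R - x) ^ 2) := by
    filter_upwards [eventually_gt_atTop x] with R hR
    have hR0 : 0 < R := hx0.trans hR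
    refine re_deriv_mul_logDeriv_le hf hz hx0 hR hfx (fun z hzR => (hC z).trans ?_) ?_
    · have h1 : ‖z‖ ≤ R := by simpa using hzR
      have h2 : (1 + ‖z‖) ^ ρ ≤ (1 + R) ^ ρ := by gcongr
      have h3 : 0 ≤ (1 + ‖z‖) ^ ρ := by positivity
      refine Real.exp_le_exp.2 ?_
      have h4 : C ≤ K := by
        have := le_abs_self C; have := abs_nonneg L; simp only [K]; linarith
      have h5 : 0 ≤ K := by positivity
      nlinarith
    · have h1 := hpow R hR0.le
      have h2 : L < K := by
        have := le_abs_self L; have := abs_nonneg C; simp only [K]; linarith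
      have h5 : 0 ≤ K := by positivity
      change L < _
      nlinarith
  have hO : (fun R : ℝ => K * (1 + R) ^ ρ - L) =o[atTop] fun R => R - x := by
    have ht : Tendsto (fun R : ℝ => 1 + R) atTop atTop := tendsto_atTop_add_const_left _ _ tendsto_id
    have h1 : (fun R : ℝ => 1 + R) =O[atTop] fun R => R - x := by
      refine Asymptotics.IsBigO.of_bound 2 ?_
      filter_upwards [eventually_gt_atTop (1 + 2 * x)] with R hR
      rw [Real.norm_of_nonneg (by linarith), Real.norm_of_nonneg (by linarith)]
      linarith
    have h2 : (fun R : ℝ => (1 + R) ^ ρ) =o[atTop] fun R => R - x := by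
      refine Asymptotics.IsLittleO.trans_isBigO ?_ h1
      refine (Asymptotics.isLittleO_iff_tendsto' ?_).2 ?_
      · filter_upwards [eventually_gt_atTop 0] with R hR h0
        linarith
      · refine ((tendsto_rpow_neg_atTop (sub_pos.2 hρ)).comp ht).congr' ?_
        filter_upwards [eventually_gt_atTop 0] with R hR
        rw [Function.comp_apply, neg_sub, Real.rpow_sub_one (by linarith)]
    have h3 : (fun _ : ℝ => L) =o[atTop] fun R => R - x :=
      (Asymptotics.isLittleO_const_id_atTop L).comp_tendsto
        (tendsto_atTop_add_const_right _ (-x) tendsto_id)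
    exact (h2.const_mul_left K).sub h3
  have h0 := hO.tendsto_div_nhds_zero
  have hinv : Tendsto (fun R : ℝ => (R - x)⁻¹) atTop (𝓝 0) :=
    tendsto_inv_atTop_zero.comp (tendsto_atTop_add_const_right _ (-x) tendsto_id)
  have hlim : Tendsto (fun R => 4 * (K * (1 + R) ^ ρ - L) / (R - x) +
      x * (16 * (K * (1 + R) ^ ρ - L) / (R - x) ^ 2)) atTop (𝓝 0) := by
    have := (h0.const_mul 4).add ((h0.mul hinv).const_mul (16 * x))
    simp only [mul_zero, add_zero] at this
    refine this.congr fun R => ?_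
    rw [pow_two]
    simp only [div_eq_mul_inv, mul_inv]
    ring
  exact ge_of_tendsto hlim hbound

/-! ### Growth of entire functions and descent along the squaring map -/

/-- The function `f` is bounded by `exp (C * (1 + ‖z‖) ^ ρ)` for some constant `C`; for an entire
function this says that its order is at most `ρ`, with finite type when the order is `ρ`. -/
def HasExpGrowth (ρ : ℝ) (f : ℂ → ℂ) : Prop :=
  ∃ C : ℝ, ∀ z, ‖f z‖ ≤ Real.exp (C * (1 + ‖z‖) ^ ρ)

namespace HasExpGrowth

variable {ρ : ℝ} {f g : ℂ → ℂ}

theorem of_norm_le_mul (hρ : 0 ≤ ρ) {K C : ℝ}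
    (h : ∀ z, ‖f z‖ ≤ K * Real.exp (C * (1 + ‖z‖) ^ ρ)) : HasExpGrowth ρ f := by
  refine ⟨|K| + C, fun z => (h z).trans ?_⟩
  have h1 : 1 ≤ (1 + ‖z‖) ^ ρ := Real.one_le_rpow (by linarith [norm_nonneg z]) hρ
  have h2 : K ≤ Real.exp (|K| * (1 + ‖z‖) ^ ρ) := by
    have h3 := Real.add_one_le_exp (|K| * (1 + ‖z‖) ^ ρ)
    have h4 := le_abs_self K
    have h5 : |K| ≤ |K| * (1 + ‖z‖) ^ ρ := le_mul_of_one_le_right (abs_nonneg _) h1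
    linarith
  rw [add_mul, Real.exp_add]
  gcongr

theorem exists_nonneg (hf : HasExpGrowth ρ f) :
    ∃ C : ℝ, 0 ≤ C ∧ ∀ z, ‖f z‖ ≤ Real.exp (C * (1 + ‖z‖) ^ ρ) := by
  obtain ⟨C, hC⟩ := hf
  refine ⟨|C|, abs_nonneg _, fun z => (hC z).trans ?_⟩
  gcongr
  exact le_abs_self C

theorem const (hρ : 0 ≤ ρ) (c : ℂ) : HasExpGrowth ρ fun _ => c :=
  of_norm_le_mul hρ (K := ‖c‖) (C := 0) fun z => by simp

theorem sub_const (hρ : 1 ≤ ρ) (c : ℂ) : HasExpGrowth ρ fun z => z - c := by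
  refine of_norm_le_mul (by linarith) (K := 1 + ‖c‖) (C := 1) fun z => ?_
  have h0 : (1 + ‖z‖) ^ (1 : ℝ) ≤ (1 + ‖z‖) ^ ρ :=
    Real.rpow_le_rpow_of_exponent_le (by linarith [norm_nonneg z]) hρ
  rw [Real.rpow_one] at h0
  have h1 := Real.add_one_le_exp (1 * (1 + ‖z‖) ^ ρ)
  have h2 := norm_sub_le z c
  have h3 : 1 + ‖z‖ ≤ Real.exp (1 * (1 + ‖z‖) ^ ρ) := by linarith
  nlinarith [norm_nonneg c, norm_nonneg z]

theorem mul (hf : HasExpGrowth ρ f) (hg : HasExpGrowth ρ g) :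
    HasExpGrowth ρ fun z => f z * g z := by
  obtain ⟨C, hC⟩ := hf
  obtain ⟨D, hD⟩ := hg
  refine ⟨C + D, fun z => ?_⟩
  rw [norm_mul, add_mul, Real.exp_add]
  exact mul_le_mul (hC z) (hD z) (norm_nonneg _) (Real.exp_pos _).le

theorem add (hρ : 0 ≤ ρ) (hf : HasExpGrowth ρ f) (hg : HasExpGrowth ρ g) :
    HasExpGrowth ρ fun z => f z + g z := by
  obtain ⟨C, hC0, hC⟩ := hf.exists_nonneg
  obtain ⟨D, hD0, hD⟩ := hg.exists_nonneg
  refine of_norm_le_mul hρ (K := 2) (C := C + D) fun z => ?_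
  have h1 : (0 : ℝ) ≤ (1 + ‖z‖) ^ ρ := by positivity
  have h2 : Real.exp (C * (1 + ‖z‖) ^ ρ) ≤ Real.exp ((C + D) * (1 + ‖z‖) ^ ρ) := by
    gcongr; linarith
  have h3 : Real.exp (D * (1 + ‖z‖) ^ ρ) ≤ Real.exp ((C + D) * (1 + ‖z‖) ^ ρ) := by
    gcongr; linarith
  linarith [norm_add_le (f z) (g z), hC z, hD z]

theorem comp_of_le (hρ : 0 ≤ ρ) (hf : HasExpGrowth ρ f) {K σ : ℝ} (hK : 0 ≤ K)
    (hg : ∀ z, 1 + ‖g z‖ ≤ K * (1 + ‖z‖) ^ σ) : HasExpGrowth (σ * ρ) fun z => f (g z) := by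
  obtain ⟨C, hC0, hC⟩ := hf.exists_nonneg
  refine ⟨C * K ^ ρ, fun z => (hC _).trans ?_⟩
  have h1 : (1 + ‖g z‖) ^ ρ ≤ K ^ ρ * (1 + ‖z‖) ^ (σ * ρ) := by
    rw [Real.rpow_mul (by positivity), ← Real.mul_rpow hK (by positivity)]
    exact Real.rpow_le_rpow (by positivity) (hg z) hρ
  rw [mul_assoc]
  gcongr

theorem comp_const_add (hρ : 0 ≤ ρ) (hf : HasExpGrowth ρ f) (a : ℂ) :
    HasExpGrowth ρ fun z => f (z + a) := by
  have := hf.comp_of_le (g := fun z => z + a) (σ := 1) (K := 1 + ‖a‖) hρ (by positivity)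
    fun z => by
      rw [Real.rpow_one]
      nlinarith [norm_add_le z a, norm_nonneg z, norm_nonneg a]
  simpa using this

theorem dslope (hρ : 0 ≤ ρ) (hf : HasExpGrowth ρ f) (hd : Differentiable ℂ f) (c : ℂ) :
    HasExpGrowth ρ (dslope f c) := by
  obtain ⟨C, hC0, hC⟩ := hf.exists_nonneg
  have hcont : Continuous (_root_.dslope f c) := by
    rw [← continuousOn_univ]
    exact (continuousOn_dslope univ_mem).2 ⟨hd.continuous.continuousOn, hd c⟩
  obtain ⟨B, hB⟩ := (isCompact_closedBall c 1).exists_bound_of_continuousOn hcont.continuousOn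
  refine of_norm_le_mul hρ (K := 1 + ‖f c‖ + |B|) (C := C) fun z => ?_
  have h1 : 1 ≤ Real.exp (C * (1 + ‖z‖) ^ ρ) := Real.one_le_exp (by positivity)
  have hp : 0 ≤ ‖f c‖ + |B| := by positivity
  rcases le_or_gt ‖z - c‖ 1 with hz | hz
  · have h2 := hB z (by simpa [dist_eq_norm] using hz)
    have h3 := le_abs_self B
    nlinarith [norm_nonneg (f c), abs_nonneg B]
  · have hzc : z ≠ c := by rintro rfl; simp at hz; linarith
    rw [dslope_of_ne _ hzc, slope_def_field, norm_div]
    have h2 : ‖f z - f c‖ / ‖z - c‖ ≤ ‖f z - f c‖ := div_le_self (norm_nonneg _) hz.le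
    have h3 := norm_sub_le (f z) (f c)
    have h4 := hC z
    nlinarith [norm_nonneg (f c), abs_nonneg B]

end HasExpGrowth

theorem differentiable_dslope {f : ℂ → ℂ} (hf : Differentiable ℂ f) (c : ℂ) :
    Differentiable ℂ (dslope f c) := by
  rw [← differentiableOn_univ]
  exact (Complex.differentiableOn_dslope univ_mem).2 hf.differentiableOn

/-- An even entire function is an entire function of the square of its argument. -/
theorem exists_entire_sq_eq {F : ℂ → ℂ} (hF : Differentiable ℂ F) (heven : ∀ z, F (-z) = F z) :
    ∃ f : ℂ → ℂ, Differentiable ℂ f ∧ ∀ z, f (z ^ 2) = F z := by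
  have hsq : ∀ z w : ℂ, z ^ 2 = w ^ 2 → F z = F w := fun z w h => by
    rcases sq_eq_sq_iff_eq_or_eq_neg.1 h with rfl | rfl
    · rfl
    · exact heven w
  have hroot : ∀ w : ℂ, (w ^ (1 / 2 : ℂ)) ^ 2 = w := fun w => by
    rw [← Complex.cpow_nat_mul]; norm_num
  set f : ℂ → ℂ := fun w => F (w ^ (1 / 2 : ℂ)) with hfdef
  have hfs : ∀ z, f (z ^ 2) = F z := fun z => hsq _ _ (hroot _)
  have hne : ∀ w : ℂ, w ≠ 0 → DifferentiableAt ℂ f w := by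
    intro w hw
    by_cases hs : w ∈ Complex.slitPlane
    · exact (hF _).comp w (DifferentiableAt.cpow_const differentiableAt_id hs)
    · -- across the cut, use the branch `I * sqrt (-w)` of the square root
      have hs' : -w ∈ Complex.slitPlane := by
        rw [Complex.mem_slitPlane_iff] at hs ⊢
        push Not at hs
        left
        have : w.re ≠ 0 := fun h => hw (Complex.ext h hs.2)
        rw [Complex.neg_re]
        exact neg_pos.2 (lt_of_le_of_ne hs.1 this)
      have he : f = fun w => F (Complex.I * (-w) ^ (1 / 2 : ℂ)) := by
        funext w
        refine hsq _ _ ?_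
        rw [hroot, mul_pow, hroot, Complex.I_sq]; ring
      rw [he]
      refine (hF _).comp w (DifferentiableAt.const_mul ?_ _)
      exact DifferentiableAt.cpow_const differentiableAt_id.neg hs'
  have hc0 : ContinuousAt f 0 := by
    refine ContinuousAt.comp (g := F) hF.continuous.continuousAt ?_
    have hh := Complex.continuousAt_cpow_zero_of_re_pos (z := (1 / 2 : ℂ)) (by norm_num)
    exact ContinuousAt.comp (f := fun w : ℂ => (w, (1 / 2 : ℂ))) hh (by fun_prop)
  refine ⟨f, fun w => ?_, hfs⟩
  rcases eq_or_ne w 0 with rfl | hw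
  · exact (Complex.analyticAt_of_differentiable_on_punctured_nhds_of_continuousAt
      (eventually_nhdsWithin_of_forall fun z hz => hne z hz) hc0).differentiableAt
  · exact hne w hw

/-- Passing to the square of the variable halves the order. -/
theorem HasExpGrowth.of_sq {ρ : ℝ} (hρ : 0 ≤ ρ) {f F : ℂ → ℂ} (hF : HasExpGrowth ρ F)
    (h : ∀ z, f (z ^ 2) = F z) : HasExpGrowth (1 / 2 * ρ) f := by
  have hroot : ∀ w : ℂ, (w ^ (1 / 2 : ℂ)) ^ 2 = w := fun w => by
    rw [← Complex.cpow_nat_mul]; norm_num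
  have h1 := hF.comp_of_le (g := fun w => w ^ (1 / 2 : ℂ)) (σ := 1 / 2) (K := 2) hρ (by norm_num)
    fun w => by
      have h2 : ‖w ^ (1 / 2 : ℂ)‖ ^ 2 = ‖w‖ := by rw [← norm_pow, hroot]
      have h3 : ‖w ^ (1 / 2 : ℂ)‖ ≤ (1 + ‖w‖) ^ (1 / 2 : ℝ) := by
        rw [← Real.sqrt_eq_rpow]
        refine Real.le_sqrt_of_sq_le ?_
        rw [h2]; linarith
      have h4 : 1 ≤ (1 + ‖w‖) ^ (1 / 2 : ℝ) :=
        Real.one_le_rpow (by linarith [norm_nonneg w]) (by norm_num)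
      linarith
  convert h1 using 2 with w
  rw [← h, hroot]

/-! ### Theta series of the Gaussian lattice with the harmonic polynomials `(p₁ + i p₂) ^ k` -/

/-- The lattice point `p` of `ℤ × ℤ` as the Gaussian integer `p₁ + i p₂`. -/
noncomputable def gaussPoint (p : ℤ × ℤ) : ℂ := (p.1 : ℂ) + (p.2 : ℂ) * Complex.I

/-- The norm `p₁² + p₂²` of the Gaussian integer `p₁ + i p₂`. -/
noncomputable def gaussNorm (p : ℤ × ℤ) : ℝ := (p.1 : ℝ) ^ 2 + (p.2 : ℝ) ^ 2

theorem norm_gaussPoint_sq (p : ℤ × ℤ) : ‖gaussPoint p‖ ^ 2 = gaussNorm p := by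
  rw [← Complex.normSq_eq_norm_sq, gaussPoint, gaussNorm, Complex.normSq_apply]
  simp; ring

theorem norm_gaussPoint_le (p : ℤ × ℤ) : ‖gaussPoint p‖ ≤ |(p.1 : ℝ)| + |(p.2 : ℝ)| := by
  refine (norm_add_le _ _).trans (le_of_eq ?_)
  simp

theorem gaussNorm_nonneg (p : ℤ × ℤ) : 0 ≤ gaussNorm p := by
  rw [gaussNorm]; positivity

@[simp] theorem gaussPoint_zero : gaussPoint 0 = 0 := by simp [gaussPoint]

@[simp] theorem gaussNorm_zero : gaussNorm 0 = 0 := by simp [gaussNorm]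

theorem one_le_gaussNorm {p : ℤ × ℤ} (hp : p ≠ 0) : 1 ≤ gaussNorm p := by
  have h : (1 : ℤ) ≤ p.1 ^ 2 + p.2 ^ 2 := by
    by_contra h
    have h1 : p.1 ^ 2 = 0 := by nlinarith [sq_nonneg p.1, sq_nonneg p.2]
    have h2 : p.2 ^ 2 = 0 := by nlinarith [sq_nonneg p.1, sq_nonneg p.2]
    exact hp (Prod.ext (by simpa using h1) (by simpa using h2))
  rw [gaussNorm]; exact_mod_cast h

theorem gaussNorm_pos {p : ℤ × ℤ} (hp : p ≠ 0) : 0 < gaussNorm p :=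
  one_pos.trans_le (one_le_gaussNorm hp)

/-- Gaussian weights dominate exponentials on the lattice. -/
theorem summable_exp_norm_mul_exp_neg {S x : ℝ} (hS : 0 ≤ S) (hx : 0 < x) :
    Summable fun p : ℤ × ℤ =>
      Real.exp (S * ‖gaussPoint p‖) * Real.exp (-Real.pi * gaussNorm p * x) := by
  have h1 := summable_pow_mul_jacobiTheta₂_term_bound (S / (2 * Real.pi)) hx 0
  simp only [pow_zero, one_mul, Int.cast_abs] at h1
  have h2 := h1.mul_of_nonneg h1 (fun _ => (Real.exp_pos _).le) (fun _ => (Real.exp_pos _).le)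
  refine h2.of_nonneg_of_le (fun _ => by positivity) fun p => ?_
  rw [← Real.exp_add, ← Real.exp_add]
  refine Real.exp_le_exp.2 ?_
  have h3 := mul_le_mul_of_nonneg_left (norm_gaussPoint_le p) hS
  rw [gaussNorm]
  have h4 : ∀ n : ℝ, -Real.pi * (x * n ^ 2 - 2 * (S / (2 * Real.pi)) * |n|) =
      -Real.pi * n ^ 2 * x + S * |n| := fun n => by
    field_simp; ring
  rw [h4, h4]
  linarith

theorem summable_norm_pow_mul_exp_neg (k : ℕ) {x : ℝ} (hx : 0 < x) :
    Summable fun p : ℤ × ℤ => ‖gaussPoint p‖ ^ k * Real.exp (-Real.pi * gaussNorm p * x) := by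
  refine ((summable_exp_norm_mul_exp_neg zero_le_one hx).mul_left (k.factorial : ℝ)).of_nonneg_of_le
    (fun _ => by positivity) fun p => ?_
  rw [← mul_assoc]
  refine mul_le_mul_of_nonneg_right ?_ (Real.exp_pos _).le
  have := Real.pow_div_factorial_le_exp ‖gaussPoint p‖ (norm_nonneg _) k
  rw [div_le_iff₀ (by positivity)] at this
  rw [one_mul, mul_comm]
  exact this

/-- The theta series `∑ (p₁ + i p₂) ^ k * exp (-π (p₁² + p₂²) x)` of the square lattice. -/
noncomputable def gaussTheta (k : ℕ) (x : ℝ) : ℂ :=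
  ∑' p : ℤ × ℤ, gaussPoint p ^ k * (Real.exp (-Real.pi * gaussNorm p * x) : ℂ)

theorem summable_gaussTheta (k : ℕ) {x : ℝ} (hx : 0 < x) :
    Summable fun p : ℤ × ℤ =>
      gaussPoint p ^ k * (Real.exp (-Real.pi * gaussNorm p * x) : ℂ) := by
  refine Summable.of_norm ?_
  refine (summable_norm_pow_mul_exp_neg k hx).congr fun p => ?_
  rw [norm_mul, norm_pow, Complex.norm_real, Real.norm_of_nonneg (Real.exp_pos _).le]

theorem hasSum_mul_of_complex {ι κ : Type*} {f : ι → ℂ} {g : κ → ℂ} {a b : ℂ} (hf : HasSum f a)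
    (hg : HasSum g b) : HasSum (fun p : ι × κ => f p.1 * g p.2) (a * b) :=
  hf.mul hg (summable_mul_of_summable_norm hf.summable.norm hg.summable.norm)

/-- The generating function of the theta series `gaussTheta k`: along the isotropic direction
`(1, i)` the two-variable theta function of the lattice is a product of Jacobi theta functions. -/
theorem hasSum_jacobiTheta₂_mul (l : ℂ) {x : ℝ} (hx : 0 < x) :
    HasSum (fun p : ℤ × ℤ => Complex.exp (2 * Real.pi * Complex.I * l * gaussPoint p) *
      (Real.exp (-Real.pi * gaussNorm p * x) : ℂ))
      (jacobiTheta₂ l (Complex.I * x) * jacobiTheta₂ (Complex.I * l) (Complex.I * x)) := by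
  have him : 0 < (Complex.I * x).im := by simpa using hx
  have h1 := hasSum_jacobiTheta₂_term l him
  have h2 := hasSum_jacobiTheta₂_term (Complex.I * l) him
  have h3 := hasSum_mul_of_complex h1 h2
  refine h3.congr_fun fun p => ?_
  rw [jacobiTheta₂_term, jacobiTheta₂_term, ← Complex.exp_add, Complex.ofReal_exp,
    ← Complex.exp_add, gaussPoint, gaussNorm]
  congr 1
  push_cast
  linear_combination -(Real.pi * x * ((p.1 : ℂ) ^ 2 + (p.2 : ℂ) ^ 2)) * Complex.I_sq

theorem hasSum_pow_div_factorial (z : ℂ) :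
    HasSum (fun k : ℕ => z ^ k / k.factorial) (Complex.exp z) := by
  rw [Complex.exp_eq_exp_ℂ]
  exact NormedSpace.expSeries_div_hasSum_exp z

theorem hasSum_gaussTheta_generating (l : ℂ) {x : ℝ} (hx : 0 < x) :
    HasSum (fun k : ℕ => l ^ k * ((2 * Real.pi * Complex.I) ^ k / k.factorial * gaussTheta k x))
      (jacobiTheta₂ l (Complex.I * x) * jacobiTheta₂ (Complex.I * l) (Complex.I * x)) := by
  set F : (ℤ × ℤ) × ℕ → ℂ := fun q => (2 * Real.pi * Complex.I * l * gaussPoint q.1) ^ q.2 /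
    q.2.factorial * (Real.exp (-Real.pi * gaussNorm q.1 * x) : ℂ) with hF
  have hp : ∀ p : ℤ × ℤ, HasSum (fun k => F (p, k))
      (Complex.exp (2 * Real.pi * Complex.I * l * gaussPoint p) *
        (Real.exp (-Real.pi * gaussNorm p * x) : ℂ)) := fun p => by
    have h1 := (hasSum_pow_div_factorial (2 * Real.pi * Complex.I * l * gaussPoint p)).mul_right
      (Real.exp (-Real.pi * gaussNorm p * x) : ℂ)
    exact h1.congr_fun fun k => by simp only [hF]
  have hnorm : ∀ p : ℤ × ℤ, HasSum (fun k => ‖F (p, k)‖)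
      (Real.exp (2 * Real.pi * ‖l‖ * ‖gaussPoint p‖) *
        Real.exp (-Real.pi * gaussNorm p * x)) := fun p => by
    have h1 := (NormedSpace.expSeries_div_hasSum_exp
      (2 * Real.pi * ‖l‖ * ‖gaussPoint p‖)).mul_right (Real.exp (-Real.pi * gaussNorm p * x))
    rw [← Real.exp_eq_exp_ℝ] at h1
    refine h1.congr_fun fun k => ?_
    simp only [hF, norm_mul, norm_div, norm_pow, Complex.norm_real, Complex.norm_I]
    simp [abs_of_pos Real.pi_pos]
  have hsum : Summable F := by
    refine Summable.of_norm ?_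
    refine (summable_prod_of_nonneg fun _ => norm_nonneg _).2
      ⟨fun p => (hnorm p).summable, ?_⟩
    refine (summable_exp_norm_mul_exp_neg (S := 2 * Real.pi * ‖l‖) (by positivity) hx).congr
      fun p => (hnorm p).tsum_eq.symm
  have htot := (hsum.hasSum.prod_fiberwise hp).unique (hasSum_jacobiTheta₂_mul l hx)
  have hswap : HasSum (fun q : ℕ × (ℤ × ℤ) => F (q.2, q.1)) (∑' q, F q) :=
    (Equiv.prodComm ℕ (ℤ × ℤ)).hasSum_iff.2 hsum.hasSum
  rw [← htot]
  refine hswap.prod_fiberwise fun k => ?_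
  have := ((summable_gaussTheta k hx).hasSum).mul_left
    (l ^ k * ((2 * Real.pi * Complex.I) ^ k / k.factorial))
  rw [gaussTheta, ← mul_assoc]
  refine this.congr_fun fun p => ?_
  simp only [hF, mul_pow]
  ring

theorem jacobiTheta₂_mul_functional_equation (l : ℂ) {x : ℝ} (hx : 0 < x) :
    jacobiTheta₂ l (Complex.I * x) * jacobiTheta₂ (Complex.I * l) (Complex.I * x) =
      (x : ℂ)⁻¹ * (jacobiTheta₂ (-Complex.I * l / x) (Complex.I * (x⁻¹ : ℝ)) *
        jacobiTheta₂ (Complex.I * (-Complex.I * l / x)) (Complex.I * (x⁻¹ : ℝ))) := by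
  have hxc : (x : ℂ) ≠ 0 := by exact_mod_cast hx.ne'
  have hI := Complex.I_ne_zero
  have e0 : -Complex.I * (Complex.I * x) = x := by
    rw [← mul_assoc, neg_mul, Complex.I_mul_I]; ring
  have e1 : l / (Complex.I * x) = -Complex.I * l / x := by
    field_simp; rw [Complex.I_sq]; ring
  have e2 : Complex.I * l / (Complex.I * x) = Complex.I * (-Complex.I * l / x) := by
    field_simp; rw [Complex.I_sq]; ring
  have e3 : -1 / (Complex.I * x) = Complex.I * (x⁻¹ : ℝ) := by
    push_cast; field_simp; rw [Complex.I_sq]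
  rw [jacobiTheta₂_functional_equation l, jacobiTheta₂_functional_equation (Complex.I * l),
    e0, e1, e2, e3]
  have hroot : ((x : ℂ) ^ (1 / 2 : ℂ)) * (x : ℂ) ^ (1 / 2 : ℂ) = x := by
    rw [← Complex.cpow_add _ _ hxc]; norm_num
  have hexp : Complex.exp (-Real.pi * Complex.I * l ^ 2 / (Complex.I * x)) *
      Complex.exp (-Real.pi * Complex.I * (Complex.I * l) ^ 2 / (Complex.I * x)) = 1 := by
    rw [← Complex.exp_add, mul_pow, Complex.I_sq, Complex.exp_eq_one_iff]
    exact ⟨0, by ring⟩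
  generalize jacobiTheta₂ (-Complex.I * l / x) (Complex.I * (x⁻¹ : ℝ)) = a
  generalize jacobiTheta₂ (Complex.I * (-Complex.I * l / x)) (Complex.I * (x⁻¹ : ℝ)) = b
  generalize Complex.exp (-Real.pi * Complex.I * l ^ 2 / (Complex.I * x)) = u at hexp ⊢
  generalize Complex.exp (-Real.pi * Complex.I * (Complex.I * l) ^ 2 / (Complex.I * x)) = v
    at hexp ⊢
  have hinv : 1 / (x : ℂ) ^ (1 / 2 : ℂ) * (1 / (x : ℂ) ^ (1 / 2 : ℂ)) = (x : ℂ)⁻¹ := by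
    rw [div_mul_div_comm, hroot]; simp
  rw [← hinv]
  linear_combination (1 / (x : ℂ) ^ (1 / 2 : ℂ) * (1 / (x : ℂ) ^ (1 / 2 : ℂ)) * a * b) * hexp

theorem eq_of_hasSum_pow_mul {a b : ℕ → ℂ} {F : ℂ → ℂ} (ha : ∀ l, HasSum (fun k => l ^ k * a k) (F l))
    (hb : ∀ l, HasSum (fun k => l ^ k * b k) (F l)) : a = b := by
  have h : ∀ c : ℕ → ℂ, (∀ l, HasSum (fun k => l ^ k * c k) (F l)) →
      HasFPowerSeriesAt F (FormalMultilinearSeries.ofScalars ℂ c) 0 := fun c hc =>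
    hasFPowerSeriesAt_iff.2 (Eventually.of_forall fun l => by
      simpa [FormalMultilinearSeries.coeff_ofScalars] using hc l)
  have := (h a ha).eq_formalMultilinearSeries (h b hb)
  funext k
  simpa [FormalMultilinearSeries.coeff_ofScalars] using
    congrArg (fun p : FormalMultilinearSeries ℂ ℂ ℂ => p.coeff k) this

/-- The modularity of the theta series with harmonic polynomial of degree `k = 4 j`, obtained by
comparing Taylor coefficients in the functional equation of the generating function. -/
theorem gaussTheta_inv (j : ℕ) {x : ℝ} (hx : 0 < x) :
    gaussTheta (4 * j) x⁻¹ = (x : ℂ) ^ (4 * j + 1) * gaussTheta (4 * j) x := by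
  have hxc : (x : ℂ) ≠ 0 := by exact_mod_cast hx.ne'
  have h := eq_of_hasSum_pow_mul (fun l => hasSum_gaussTheta_generating l hx)
    (b := fun k => (x : ℂ)⁻¹ * ((-Complex.I / x) ^ k *
      ((2 * Real.pi * Complex.I) ^ k / k.factorial * gaussTheta k x⁻¹))) fun l => by
    rw [jacobiTheta₂_mul_functional_equation l hx]
    have := (hasSum_gaussTheta_generating (-Complex.I * l / x) (inv_pos.2 hx)).mul_left (x : ℂ)⁻¹
    refine this.congr_fun fun k => ?_
    rw [show -Complex.I * l / x = l * (-Complex.I / x) by ring, mul_pow]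
    ring
  have h1 := congrFun h (4 * j)
  have hI : (-Complex.I / x) ^ (4 * j) = 1 / (x : ℂ) ^ (4 * j) := by
    rw [div_pow, pow_mul (-Complex.I), neg_pow, Complex.I_pow_four]; norm_num
  simp only [hI] at h1
  have h2 : (2 * Real.pi * Complex.I) ^ (4 * j) / ((4 * j).factorial : ℂ) ≠ 0 := by
    refine div_ne_zero (pow_ne_zero _ ?_) (by exact_mod_cast (Nat.factorial_pos _).ne')
    simp [Real.pi_ne_zero]
  have h3 : gaussTheta (4 * j) x = (x : ℂ)⁻¹ * (1 / (x : ℂ) ^ (4 * j) * gaussTheta (4 * j) x⁻¹) := by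
    refine mul_left_cancel₀ h2 ?_
    rw [h1]; ring
  rw [h3, pow_succ]
  field_simp

/-- Away from the constant term the theta series decays exponentially. -/
theorem exists_norm_gaussTheta_sub_le (k : ℕ) :
    ∃ C : ℝ, ∀ x : ℝ, 1 ≤ x → ‖gaussTheta k x - (0 : ℂ) ^ k‖ ≤ C * Real.exp (-x) := by
  have hs := summable_norm_pow_mul_exp_neg k (x := 1 / 2) (by norm_num)
  refine ⟨∑' p : ℤ × ℤ, ‖gaussPoint p‖ ^ k * Real.exp (-Real.pi * gaussNorm p * (1 / 2)),
    fun x hx => ?_⟩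
  have hx0 : 0 < x := by linarith
  have hsum := summable_gaussTheta k hx0
  have h1 : gaussTheta k x - (0 : ℂ) ^ k = ∑' p : ℤ × ℤ, if p = 0 then 0 else
      gaussPoint p ^ k * (Real.exp (-Real.pi * gaussNorm p * x) : ℂ) := by
    rw [gaussTheta, hsum.tsum_eq_add_tsum_ite 0]
    simp
  rw [h1, mul_comm, ← tsum_mul_left]
  refine tsum_of_norm_bounded (hs.mul_left _).hasSum fun p => ?_
  split_ifs with hp
  · rw [norm_zero]; positivity
  · rw [norm_mul, norm_pow, Complex.norm_real, Real.norm_of_nonneg (Real.exp_pos _).le,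
      mul_left_comm, ← Real.exp_add]
    refine mul_le_mul_of_nonneg_left (Real.exp_le_exp.2 ?_) (by positivity)
    have h2 := one_le_gaussNorm hp
    have h3 := Real.pi_gt_three
    have h4 : x + gaussNorm p - 1 ≤ gaussNorm p * x := by nlinarith
    have h5 : Real.pi * gaussNorm p * x ≥ Real.pi * gaussNorm p * (1 / 2) + x := by
      have h6 : x ≤ 3 * (gaussNorm p * (x - 1 / 2)) := by nlinarith
      have h7 : 0 ≤ gaussNorm p * (x - 1 / 2) := by nlinarith
      nlinarith
    linarith

theorem continuousOn_gaussTheta (k : ℕ) : ContinuousOn (gaussTheta k) (Set.Ioi 0) := by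
  intro x hx
  have hx' : (0 : ℝ) < x := hx
  have h : ContinuousOn (gaussTheta k) (Set.Ioi (x / 2)) := by
    refine continuousOn_tsum (fun p => by fun_prop)
      (summable_norm_pow_mul_exp_neg k (half_pos hx')) fun p y hy => ?_
    rw [norm_mul, norm_pow, Complex.norm_real, Real.norm_of_nonneg (Real.exp_pos _).le]
    refine mul_le_mul_of_nonneg_left (Real.exp_le_exp.2 ?_) (by positivity)
    have h1 : x / 2 < y := hy
    have := mul_nonneg Real.pi_pos.le (gaussNorm_nonneg p)
    nlinarith
  exact (h.continuousAt (Ioi_mem_nhds (half_lt_self hx'))).continuousWithinAt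

theorem gaussTheta_sub_isBigO_rpow (k : ℕ) (r : ℝ) :
    (fun x => gaussTheta k x - (0 : ℂ) ^ k) =O[atTop] (fun x : ℝ => x ^ r) := by
  obtain ⟨C, hC⟩ := exists_norm_gaussTheta_sub_le k
  have h1 : (fun x => gaussTheta k x - (0 : ℂ) ^ k) =O[atTop] fun x : ℝ => Real.exp (-x) :=
    Asymptotics.IsBigO.of_bound C (by
      filter_upwards [eventually_ge_atTop 1] with x hx
      rw [Real.norm_of_nonneg (Real.exp_pos _).le]
      exact hC x hx)
  refine h1.trans ?_
  simpa using (isLittleO_exp_neg_mul_rpow_atTop one_pos r).isBigO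

/-- The theta series with harmonic polynomial of degree `4 j`, with its modularity, as input to the
Mellin transform. The weight is `4 j + 1`, and there is a constant term only for `j = 0`. -/
noncomputable def gaussPair (j : ℕ) : WeakFEPair ℂ where
  f := gaussTheta (4 * j)
  g := gaussTheta (4 * j)
  k := 4 * j + 1
  ε := 1
  f₀ := 0 ^ (4 * j)
  g₀ := 0 ^ (4 * j)
  hf_int := (continuousOn_gaussTheta _).locallyIntegrableOn measurableSet_Ioi
  hg_int := (continuousOn_gaussTheta _).locallyIntegrableOn measurableSet_Ioi
  hk := by positivity
  hε := one_ne_zero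
  h_feq x hx := by
    rw [one_div, gaussTheta_inv j hx, one_mul, smul_eq_mul]
    congr 1
    norm_cast
  hf_top := gaussTheta_sub_isBigO_rpow _
  hg_top := gaussTheta_sub_isBigO_rpow _

theorem gaussPair_symm (j : ℕ) : (gaussPair j).symm = gaussPair j := by
  simp [WeakFEPair.symm, gaussPair]

theorem gaussPair_functional_equation₀ (j : ℕ) (s : ℂ) :
    (gaussPair j).Λ₀ (4 * j + 1 - s) = (gaussPair j).Λ₀ s := by
  have := (gaussPair j).functional_equation₀ s
  rw [gaussPair_symm] at this
  simpa [gaussPair] using this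

/-! ### The completed lattice sums: growth and Dirichlet series -/

theorem natCast_factorial_le_exp_rpow (n : ℕ) :
    (n.factorial : ℝ) ≤ Real.exp (2 * (n : ℝ) ^ (3 / 2 : ℝ)) := by
  rcases Nat.eq_zero_or_pos n with rfl | hn
  · simp [Real.zero_rpow]
  have hn' : (0 : ℝ) < n := by exact_mod_cast hn
  have h1 : (n.factorial : ℝ) ≤ (n : ℝ) ^ n := by exact_mod_cast Nat.factorial_le_pow n
  refine h1.trans ?_
  rw [← Real.rpow_natCast, Real.rpow_def_of_pos hn']
  refine Real.exp_le_exp.2 ?_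
  have h2 : Real.log n ≤ 2 * (n : ℝ) ^ (1 / 2 : ℝ) := by
    have := Real.log_le_rpow_div hn'.le (show (0 : ℝ) < 1 / 2 by norm_num)
    linarith
  have h3 : (n : ℝ) ^ (3 / 2 : ℝ) = (n : ℝ) ^ (1 / 2 : ℝ) * n := by
    rw [← Real.rpow_add_one hn'.ne']; norm_num
  rw [h3]
  nlinarith

theorem exists_norm_gaussPair_le_of_le_re (j : ℕ) :
    ∃ K : ℝ, ∀ s : ℂ, (4 * j + 1 : ℝ) / 2 ≤ s.re →
      ‖(gaussPair j).Λ₀ s‖ ≤ K * Real.exp (2 * (1 + ‖s‖) ^ (3 / 2 : ℝ)) := by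
  set P := gaussPair j with hP
  obtain ⟨C, hC⟩ := exists_norm_gaussTheta_sub_le (4 * j)
  set c : ℝ := (4 * j + 1 : ℝ) / 2 with hc
  have hc0 : 0 < c := by positivity
  have hconv : IntegrableOn (fun t : ℝ => t ^ (c - 1) * ‖P.f_modif t‖) (Set.Ioi 0) := by
    have h1 : MellinConvergent P.f_modif (c : ℂ) :=
      (P.isStrongFEPair_toStrongFEPair.hasMellin (c : ℂ)).1
    refine IntegrableOn.congr_fun (Integrable.norm h1) (fun t ht => ?_) measurableSet_Ioi
    simp only [norm_smul]
    rw [Complex.norm_cpow_eq_rpow_re_of_pos ht]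
    simp
  set C₁ := ∫ t in Set.Ioi (0 : ℝ), t ^ (c - 1) * ‖P.f_modif t‖ with hC₁
  refine ⟨|C₁| + |C|, fun s hs => ?_⟩
  set N := ⌈s.re⌉₊ with hN
  have hΓ : IntegrableOn (fun t : ℝ => Real.exp (-t) * t ^ ((N + 1 : ℝ) - 1)) (Set.Ioi 0) :=
    Real.GammaIntegral_convergent (by positivity)
  have hle : ‖P.Λ₀ s‖ ≤ ∫ t in Set.Ioi (0 : ℝ), (t ^ (c - 1) * ‖P.f_modif t‖ +
      |C| * (Real.exp (-t) * t ^ ((N + 1 : ℝ) - 1))) := by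
    refine norm_integral_le_of_norm_le (hconv.add (hΓ.const_mul _)) ?_
    refine (ae_restrict_iff' measurableSet_Ioi).2 (ae_of_all _ fun t (ht : 0 < t) => ?_)
    rw [norm_smul, Complex.norm_cpow_eq_rpow_re_of_pos ht, Complex.sub_re, Complex.one_re]
    rcases le_or_gt t 1 with h1 | h1
    · have h2 : t ^ (s.re - 1) ≤ t ^ (c - 1) :=
        Real.rpow_le_rpow_of_exponent_ge ht h1 (by linarith)
      have h3 : 0 ≤ |C| * (Real.exp (-t) * t ^ ((N + 1 : ℝ) - 1)) := by positivity
      have h4 := mul_le_mul_of_nonneg_right h2 (norm_nonneg (P.f_modif t))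
      linarith
    · have h2 : ‖P.f_modif t‖ ≤ |C| * Real.exp (-t) := by
        have h3 : P.f_modif t = gaussTheta (4 * j) t - 0 ^ (4 * j) := by
          simp only [WeakFEPair.f_modif, Pi.add_apply]
          rw [Set.indicator_of_mem (Set.mem_Ioi.2 h1),
            Set.indicator_of_notMem (Set.notMem_Ioo_of_ge h1.le), add_zero]
          rfl
        rw [h3]
        refine (hC t h1.le).trans ?_
        gcongr
        exact le_abs_self C
      have h3 : t ^ (s.re - 1) ≤ t ^ ((N + 1 : ℝ) - 1) := by
        refine Real.rpow_le_rpow_of_exponent_le h1.le ?_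
        have := Nat.le_ceil s.re
        linarith
      have h4 : 0 ≤ t ^ (c - 1) * ‖P.f_modif t‖ := by positivity
      have h5 := mul_le_mul h3 h2 (norm_nonneg _) (by positivity)
      nlinarith
  rw [integral_add hconv (hΓ.const_mul _), integral_const_mul, ← Real.Gamma_eq_integral
    (by positivity), Real.Gamma_nat_eq_factorial] at hle
  have hs0 : 0 ≤ s.re := hc0.le.trans hs
  have hNs : (N : ℝ) ≤ 1 + ‖s‖ := by
    have h1 := (Nat.ceil_lt_add_one hs0).le
    have h2 := Complex.re_le_norm s
    linarith
  have hfac : (N.factorial : ℝ) ≤ Real.exp (2 * (1 + ‖s‖) ^ (3 / 2 : ℝ)) := by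
    refine (natCast_factorial_le_exp_rpow N).trans ?_
    gcongr
  have h1 : 1 ≤ Real.exp (2 * (1 + ‖s‖) ^ (3 / 2 : ℝ)) := Real.one_le_exp (by positivity)
  have h2 := mul_le_mul_of_nonneg_left hfac (abs_nonneg C)
  have h3 := mul_le_mul_of_nonneg_left h1 (abs_nonneg C₁)
  have h4 := le_abs_self C₁
  linarith

theorem hasExpGrowth_gaussPair (j : ℕ) : HasExpGrowth (3 / 2) (gaussPair j).Λ₀ := by
  obtain ⟨K, hK⟩ := exists_norm_gaussPair_le_of_le_re j
  set κ : ℝ := 4 * j + 1 with hκ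
  have hκ0 : 0 ≤ κ := by positivity
  refine HasExpGrowth.of_norm_le_mul (by norm_num) (K := |K|)
    (C := 2 * (1 + κ) ^ (3 / 2 : ℝ)) fun s => ?_
  have key : ∀ w : ℂ, ‖w‖ ≤ κ + ‖s‖ → |K| * Real.exp (2 * (1 + ‖w‖) ^ (3 / 2 : ℝ)) ≤
      |K| * Real.exp (2 * (1 + κ) ^ (3 / 2 : ℝ) * (1 + ‖s‖) ^ (3 / 2 : ℝ)) := fun w hw => by
    rw [mul_assoc 2, ← Real.mul_rpow (by positivity) (by positivity)]
    gcongr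
    nlinarith [norm_nonneg s]
  have habs : ∀ w : ℂ, κ / 2 ≤ w.re →
      ‖(gaussPair j).Λ₀ w‖ ≤ |K| * Real.exp (2 * (1 + ‖w‖) ^ (3 / 2 : ℝ)) := fun w hw =>
    (hK w hw).trans (by gcongr; exact le_abs_self K)
  rcases le_or_gt (κ / 2) s.re with h | h
  · exact (habs s h).trans (key s (by linarith))
  · rw [← gaussPair_functional_equation₀]
    refine (habs _ ?_).trans (key _ ?_)
    · simp [hκ] at h ⊢; linarith
    · refine (norm_sub_le _ _).trans ?_
      have : ‖(4 * j + 1 : ℂ)‖ = κ := by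
        rw [show (4 * j + 1 : ℂ) = (κ : ℂ) by simp [hκ], Complex.norm_real,
          Real.norm_of_nonneg hκ0]
      rw [this]

theorem summable_gaussNorm_rpow {σ : ℝ} (hσ : 1 < σ) :
    Summable fun p : ℤ × ℤ => gaussNorm p ^ (-σ) := by
  have h1 := EisensteinSeries.summable_one_div_norm_rpow (k := 2 * σ) (by linarith)
  rw [← (finTwoArrowEquiv _).symm.summable_iff] at h1
  refine h1.of_nonneg_of_le (fun p => Real.rpow_nonneg (gaussNorm_nonneg p) _) fun p => ?_
  rcases eq_or_ne p 0 with rfl | hp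
  · rw [gaussNorm_zero, Real.zero_rpow (by linarith)]
    exact Real.rpow_nonneg (norm_nonneg _) _
  · rw [Function.comp_apply]
    set v : Fin 2 → ℤ := (finTwoArrowEquiv ℤ).symm p with hv
    have hv0 : 0 < ‖v‖ := by
      refine norm_pos_iff.2 fun h => hp ?_
      have := congrArg (finTwoArrowEquiv ℤ) h
      rw [hv, Equiv.apply_symm_apply] at this
      rw [this]; rfl
    have hle : ‖v‖ ^ 2 ≤ gaussNorm p := by
      have h2 : ‖v‖ ≤ Real.sqrt (gaussNorm p) := by
        refine (pi_norm_le_iff_of_nonneg (Real.sqrt_nonneg _)).2 fun i => ?_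
        refine Real.le_sqrt_of_sq_le ?_
        rw [gaussNorm]
        fin_cases i <;> simp [hv, Int.norm_eq_abs] <;> positivity
      calc ‖v‖ ^ 2 ≤ Real.sqrt (gaussNorm p) ^ 2 := by gcongr
        _ = gaussNorm p := Real.sq_sqrt (gaussNorm_nonneg p)
    have h3 : ‖v‖ ^ (-(2 * σ)) = (‖v‖ ^ 2) ^ (-σ) := by
      rw [← Real.rpow_natCast, ← Real.rpow_mul hv0.le]; norm_num
    rw [h3]
    exact Real.rpow_le_rpow_of_nonpos (by positivity) hle (by linarith)

theorem norm_gaussPoint_pow (j : ℕ) (p : ℤ × ℤ) :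
    ‖gaussPoint p‖ ^ (4 * j) = gaussNorm p ^ (2 * j) := by
  rw [← norm_gaussPoint_sq, ← pow_mul]; congr 1; ring

theorem summable_norm_gaussPoint_pow_div (j : ℕ) {σ : ℝ} (hσ : 1 < σ) :
    Summable fun p : ℤ × ℤ => ‖gaussPoint p ^ (4 * j)‖ / gaussNorm p ^ (σ + 2 * j) := by
  refine (summable_gaussNorm_rpow hσ).congr fun p => ?_
  rw [norm_pow, norm_gaussPoint_pow]
  rcases eq_or_ne p 0 with rfl | hp
  · have : σ + 2 * (j : ℝ) ≠ 0 := by positivity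
    rw [gaussNorm_zero, Real.zero_rpow (by linarith), Real.zero_rpow this, div_zero]
  · have h := gaussNorm_pos hp
    have h2 : gaussNorm p ^ (2 * j : ℝ) = gaussNorm p ^ (2 * j) := by
      rw [← Real.rpow_natCast]; push_cast; rfl
    rw [Real.rpow_neg h.le, Real.rpow_add h, h2]
    field_simp

/-- The Mellin transform of the theta series, as a Dirichlet series. -/
theorem hasSum_gaussPair_Λ (j : ℕ) {s : ℂ} (hs : 1 < s.re) :
    HasSum (fun p : ℤ × ℤ => (Real.pi : ℂ) ^ (-(s + 2 * j)) * Complex.Gamma (s + 2 * j) *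
      gaussPoint p ^ (4 * j) / (gaussNorm p : ℂ) ^ (s + 2 * j)) ((gaussPair j).Λ (s + 2 * j)) := by
  have hre : (s + 2 * j).re = s.re + 2 * j := by simp
  have hmel : mellin (fun t => gaussTheta (4 * j) t - 0 ^ (4 * j)) (s + 2 * j) =
      (gaussPair j).Λ (s + 2 * j) := by
    rcases Nat.eq_zero_or_pos j with rfl | hj
    · refine ((gaussPair 0).hasMellin ?_).2
      rw [hre]; simpa [gaussPair] using hs
    · have h0 : (0 : ℂ) ^ (4 * j) = 0 := zero_pow (by positivity)
      have hst : IsStrongFEPair (gaussPair j) := ⟨h0, h0⟩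
      have := (hst.hasMellin (s + 2 * j)).2
      simp only [h0, sub_zero]
      exact this
  rw [← hmel]
  refine hasSum_mellin_pi_mul₀ gaussNorm_nonneg (by rw [hre]; positivity) (fun t ht => ?_) ?_
  · have hsum := summable_gaussTheta (4 * j) (x := t) ht
    have h1 := hsum.hasSum.sub (hasSum_ite_eq (0 : ℤ × ℤ) ((0 : ℂ) ^ (4 * j)))
    refine h1.congr_fun fun p => ?_
    rcases eq_or_ne p 0 with rfl | hp
    · simp
    · rw [if_neg (gaussNorm_pos hp).ne', if_neg hp, sub_zero]
  · rw [hre]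
    exact summable_norm_gaussPoint_pow_div j hs

theorem cos_mul_arg_eq {z : ℂ} (hz : z ≠ 0) (k : ℕ) :
    Real.cos (k * Complex.arg z) = (z ^ k).re / ‖z‖ ^ k := by
  have h : z ^ k = ((‖z‖ ^ k : ℝ) : ℂ) * Complex.exp (((k * Complex.arg z : ℝ) : ℂ) * Complex.I) := by
    conv_lhs => rw [← Complex.norm_mul_exp_arg_mul_I z]
    rw [mul_pow, ← Complex.exp_nat_mul]
    push_cast
    rw [mul_assoc]
  rw [h, Complex.re_ofReal_mul, Complex.exp_ofReal_mul_I_re]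
  have : ‖z‖ ≠ 0 := norm_ne_zero_iff.2 hz
  field_simp

/-- In the angular lattice sum the cosine may be replaced by the complex harmonic polynomial: the
sine part cancels under complex conjugation of the lattice. -/
theorem hasSum_latticeSeries (j : ℕ) {s : ℂ} (hs : 1 < s.re) :
    HasSum (fun p : ℤ × ℤ => gaussPoint p ^ (4 * j) / (gaussNorm p : ℂ) ^ (s + 2 * j))
      (AngularLattice.latticeSeries 1 (4 * j) s) := by
  set u : ℤ × ℤ → ℂ := fun p => gaussPoint p ^ (4 * j) / (gaussNorm p : ℂ) ^ (s + 2 * j) with hu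
  have hne : s + 2 * j ≠ 0 := fun h => by
    have := congrArg Complex.re h
    simp at this
    have h2 : (0 : ℝ) ≤ j := Nat.cast_nonneg j
    linarith
  have hsum : Summable u := by
    refine Summable.of_norm ?_
    have h1 := summable_norm_gaussPoint_pow_div j hs
    refine h1.congr fun p => ?_
    rw [hu, norm_div]
    rcases eq_or_ne p 0 with rfl | hp
    · have : s.re + 2 * (j : ℝ) ≠ 0 := by positivity
      rw [gaussNorm_zero, Complex.ofReal_zero, Complex.zero_cpow hne, norm_zero,
        Real.zero_rpow this]
    · rw [Complex.norm_cpow_eq_rpow_re_of_pos (gaussNorm_pos hp)]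
      simp
  set e : ℤ × ℤ ≃ ℤ × ℤ := (Equiv.refl ℤ).prodCongr (Equiv.neg ℤ) with he
  have hconj : HasSum (fun p => (starRingEnd ℂ) (gaussPoint p) ^ (4 * j) /
      (gaussNorm p : ℂ) ^ (s + 2 * j)) (∑' p, u p) := by
    have h1 := e.hasSum_iff.2 hsum.hasSum
    refine h1.congr_fun fun p => ?_
    have h2 : gaussPoint (e p) = (starRingEnd ℂ) (gaussPoint p) := by
      simp [gaussPoint, he]
    have h3 : gaussNorm (e p) = gaussNorm p := by simp [gaussNorm, he]
    simp only [Function.comp_apply, hu, h2, h3]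
  have hre : HasSum (fun p => (((gaussPoint p ^ (4 * j)).re : ℝ) : ℂ) /
      (gaussNorm p : ℂ) ^ (s + 2 * j)) (∑' p, u p) := by
    have h1 := (hsum.hasSum.add hconj).mul_left (1 / 2 : ℂ)
    have h2 : (1 / 2 : ℂ) * (∑' p, u p + ∑' p, u p) = ∑' p, u p := by ring
    rw [h2] at h1
    refine h1.congr_fun fun p => ?_
    rw [Complex.re_eq_add_conj, map_pow, hu]
    ring
  have hval : AngularLattice.latticeSeries 1 (4 * j) s = ∑' p, u p := by
    rw [AngularLattice.latticeSeries, ← hre.tsum_eq]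
    have h0 : Function.support (fun p => (((gaussPoint p ^ (4 * j)).re : ℝ) : ℂ) /
        (gaussNorm p : ℂ) ^ (s + 2 * j)) ⊆ {p : ℤ × ℤ | p ≠ 0} := by
      intro p hp h0
      refine hp ?_
      simp only [h0, gaussNorm_zero, Complex.ofReal_zero, Complex.zero_cpow hne, div_zero]
    rw [← tsum_subtype_eq_of_support_subset h0]
    refine tsum_congr fun p => ?_
    have hp : p.1 ≠ 0 := p.2
    have hN := gaussNorm_pos hp
    have hNc : (gaussNorm p.1 : ℂ) ≠ 0 := by exact_mod_cast hN.ne'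
    have hz : gaussPoint p.1 ≠ 0 := fun h => by
      have := norm_gaussPoint_sq p.1
      rw [h] at this
      simp at this
      exact hN.ne this
    have h1 : ((p.1.1 : ℂ) ^ 2 + (p.1.2 : ℂ) ^ 2) = (gaussNorm p.1 : ℂ) := by
      simp [gaussNorm]
    have h2 : (p.1.1 : ℂ) + (p.1.2 : ℂ) * Complex.I = gaussPoint p.1 := rfl
    rw [h1, h2, pow_one, cos_mul_arg_eq hz, norm_gaussPoint_pow, Complex.cpow_add _ _ hNc]
    have h3 : (gaussNorm p.1 : ℂ) ^ (2 * j : ℂ) = (gaussNorm p.1 : ℂ) ^ (2 * j) := by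
      rw [← Complex.cpow_natCast]; push_cast; rfl
    rw [h3]
    push_cast
    rw [div_div, mul_comm ((gaussNorm p.1 : ℂ) ^ s)]
  rw [hval]
  exact hsum.hasSum

theorem gaussPair_Λ_eq (j : ℕ) {s : ℂ} (hs : 1 < s.re) :
    (gaussPair j).Λ (s + 2 * j) = (Real.pi : ℂ) ^ (-(s + 2 * j)) * Complex.Gamma (s + 2 * j) *
      AngularLattice.latticeSeries 1 (4 * j) s := by
  refine (hasSum_gaussPair_Λ j hs).unique ?_
  refine ((hasSum_latticeSeries j hs).mul_left _).congr_fun fun p => ?_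
  rw [mul_div_assoc]

/-! ### The meromorphic continuation and the closed form of `Δ₃` -/

open AngularLattice in
theorem continuation_eq_of_meromorphicOn {f g : ℂ → ℂ} (hg : MeromorphicOn g Set.univ)
    (hfg : ∀ s : ℂ, 1 < s.re → g s = f s) (han : ∀ s : ℂ, 1 < s.re → AnalyticAt ℂ g s)
    {s : ℂ} (hs : AnalyticAt ℂ g s) : continuation f s = g s := by
  have hval : ∀ z, AnalyticAt ℂ g z → toMeromorphicNFOn g Set.univ z = g z := fun z hz => by
    rw [toMeromorphicNFOn_eq_toMeromorphicNFAt hg (Set.mem_univ z),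
      toMeromorphicNFAt_eq_self.2 hz.meromorphicNFAt]
  have hc : IsContinuation f (toMeromorphicNFOn g Set.univ) :=
    ⟨meromorphicNFOn_toMeromorphicNFOn g Set.univ, fun z hz => by rw [hval z (han z hz), hfg z hz]⟩
  have hex : ∃ g, IsContinuation f g := ⟨_, hc⟩
  rw [continuation, dif_pos hex, hex.choose_spec.unique hc, hval s hs]

theorem gaussPair_f₀_eq_zero {j : ℕ} (hj : j ≠ 0) : (gaussPair j).f₀ = 0 :=
  zero_pow (by positivity)

theorem gaussPair_g₀_eq_zero {j : ℕ} (hj : j ≠ 0) : (gaussPair j).g₀ = 0 :=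
  zero_pow (by positivity)

theorem gaussPair_Λ_eq_Λ₀ {j : ℕ} (hj : j ≠ 0) : (gaussPair j).Λ = (gaussPair j).Λ₀ := by
  funext s
  rw [WeakFEPair.Λ, gaussPair_f₀_eq_zero hj, gaussPair_g₀_eq_zero hj]
  simp

theorem gaussPair_zero_Λ {s : ℂ} (h0 : s ≠ 0) (h1 : s ≠ 1) :
    s * (s - 1) * (gaussPair 0).Λ s = s * (s - 1) * (gaussPair 0).Λ₀ s + 1 := by
  have h1' : s - 1 ≠ 0 := sub_ne_zero.2 h1
  have h2 : (1 : ℂ) - s ≠ 0 := sub_ne_zero.2 h1.symm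
  simp only [WeakFEPair.Λ, gaussPair]
  simp
  field_simp
  ring

theorem analyticAt_gaussPair_Λ {j : ℕ} {s : ℂ} (h : j ≠ 0 ∨ s ≠ 0 ∧ s ≠ 1) :
    AnalyticAt ℂ (fun s => (gaussPair j).Λ (s + 2 * j)) s := by
  rcases Nat.eq_zero_or_pos j with rfl | hj
  · obtain ⟨h0, h1⟩ := h.resolve_left (by simp)
    rw [Complex.analyticAt_iff_eventually_differentiableAt]
    filter_upwards [isOpen_ne.mem_nhds h0, isOpen_ne.mem_nhds h1] with z hz0 hz1
    simp only [Nat.cast_zero, mul_zero, add_zero]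
    exact (gaussPair 0).differentiableAt_Λ (Or.inl hz0) (Or.inl (by simpa [gaussPair] using hz1))
  · rw [gaussPair_Λ_eq_Λ₀ hj.ne']
    exact Differentiable.analyticAt ((gaussPair j).differentiable_Λ₀.comp (by fun_prop)) s

theorem latticeC_eq (j : ℕ) {s : ℂ} (h : j ≠ 0 ∨ s ≠ 0 ∧ s ≠ 1) :
    AngularLattice.latticeC 1 (4 * j) s = (Real.pi : ℂ) ^ (s + 2 * j) *
      (Complex.Gamma (s + 2 * j))⁻¹ * (gaussPair j).Λ (s + 2 * j) := by
  have hpi : (Real.pi : ℂ) ≠ 0 := by exact_mod_cast Real.pi_ne_zero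
  have hfac : Differentiable ℂ fun s : ℂ => (Real.pi : ℂ) ^ (s + 2 * j) *
      (Complex.Gamma (s + 2 * j))⁻¹ := by
    refine Differentiable.mul (fun z => ?_) ?_
    · exact DifferentiableAt.const_cpow (by fun_prop) (Or.inl hpi)
    · exact Complex.differentiable_one_div_Gamma.comp (by fun_prop)
  have han : ∀ z : ℂ, (j ≠ 0 ∨ z ≠ 0 ∧ z ≠ 1) → AnalyticAt ℂ (fun s : ℂ =>
      (Real.pi : ℂ) ^ (s + 2 * j) * (Complex.Gamma (s + 2 * j))⁻¹ *
        (gaussPair j).Λ (s + 2 * j)) z := fun z hz =>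
    (hfac.analyticAt z).mul (analyticAt_gaussPair_Λ hz)
  have hre : ∀ z : ℂ, 1 < z.re → z ≠ 0 ∧ z ≠ 1 := fun z hz =>
    ⟨by rintro rfl; simp at hz; linarith, by rintro rfl; simp at hz⟩
  refine continuation_eq_of_meromorphicOn (g := fun s : ℂ =>
      (Real.pi : ℂ) ^ (s + 2 * j) * (Complex.Gamma (s + 2 * j))⁻¹ *
        (gaussPair j).Λ (s + 2 * j)) (fun z _ => ?_) (fun z hz => ?_)
    (fun z hz => han z (Or.inr (hre z hz))) (han s h)
  · refine (hfac.analyticAt z).meromorphicAt.mul ?_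
    have h0 : MeromorphicAt (fun s => (gaussPair j).Λ₀ (s + 2 * j)) z :=
      (Differentiable.analyticAt ((gaussPair j).differentiable_Λ₀.comp
        (by fun_prop : Differentiable ℂ fun s : ℂ => s + 2 * j)) z).meromorphicAt
    unfold WeakFEPair.Λ
    fun_prop
  · have hG : Complex.Gamma (z + 2 * j) ≠ 0 := by
      refine Complex.Gamma_ne_zero_of_re_pos ?_
      simp; positivity
    have hp : (Real.pi : ℂ) ^ (z + 2 * j) ≠ 0 := by simp [Complex.cpow_eq_zero_iff, hpi]
    simp only [gaussPair_Λ_eq j hz, Complex.cpow_neg]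
    field_simp

theorem latticeC_zero_one {s : ℂ} (h0 : s ≠ 0) (h1 : s ≠ 1) :
    AngularLattice.latticeC 0 1 s = (Real.pi : ℂ) ^ s * (Complex.Gamma s)⁻¹ * (gaussPair 0).Λ s := by
  have h := latticeC_eq 0 (Or.inr ⟨h0, h1⟩)
  have he : AngularLattice.latticeSeries 0 1 = AngularLattice.latticeSeries 1 (4 * 0) := by
    funext s
    simp [AngularLattice.latticeSeries]
  rw [AngularLattice.latticeC, he]
  simpa [AngularLattice.latticeC] using h

/-- The entire function `π ^ 2m * s (s - 1) Λ₀(s) * Λₘ(s + 2m)`, where `Λ₀` and `Λₘ` are the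
completed lattice sums of degree `0` and `4 m`. The factor `s (s - 1)` removes the poles of the
first one. -/
noncomputable def gaussXi (m : ℕ) (s : ℂ) : ℂ :=
  (Real.pi : ℂ) ^ (2 * m) * (s * (s - 1) * (gaussPair 0).Λ₀ s + 1) * (gaussPair m).Λ₀ (s + 2 * m)

theorem differentiable_gaussXi (m : ℕ) : Differentiable ℂ (gaussXi m) := by
  have h0 := (gaussPair 0).differentiable_Λ₀
  have h1 : Differentiable ℂ fun s : ℂ => (gaussPair m).Λ₀ (s + 2 * m) :=
    (gaussPair m).differentiable_Λ₀.comp (by fun_prop)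
  unfold gaussXi
  fun_prop

theorem gaussXi_one_sub (m : ℕ) (s : ℂ) : gaussXi m (1 - s) = gaussXi m s := by
  have h0 := gaussPair_functional_equation₀ 0 s
  have h1 := gaussPair_functional_equation₀ m (s + 2 * m)
  have e0 : (4 * ((0 : ℕ) : ℂ) + 1 - s) = 1 - s := by simp
  have e1 : (4 * (m : ℂ) + 1 - (s + 2 * m)) = 1 - s + 2 * m := by ring
  rw [e0] at h0
  rw [e1] at h1
  rw [gaussXi, gaussXi, h0, h1]
  ring

theorem hasExpGrowth_gaussXi (m : ℕ) : HasExpGrowth (3 / 2) (gaussXi m) := by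
  have hρ : (0 : ℝ) ≤ 3 / 2 := by norm_num
  have h1 : HasExpGrowth (3 / 2) fun s : ℂ => s * (s - 1) * (gaussPair 0).Λ₀ s + 1 := by
    have ha := HasExpGrowth.sub_const (ρ := 3 / 2) (by norm_num) 0
    simp only [sub_zero] at ha
    exact HasExpGrowth.add hρ ((ha.mul (HasExpGrowth.sub_const (by norm_num) 1)).mul
      (hasExpGrowth_gaussPair 0)) (HasExpGrowth.const hρ 1)
  exact ((HasExpGrowth.const hρ _).mul h1).mul
    ((hasExpGrowth_gaussPair m).comp_const_add hρ (2 * m))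

theorem Gamma_one_sub_add_natCast {s : ℂ} (hs : ∀ n : ℤ, s ≠ n) (n : ℕ) :
    Complex.Gamma (1 - s + n) = (∏ i ∈ Finset.range n, ((i : ℂ) + 1 - s)) * Complex.Gamma (1 - s) := by
  induction n with
  | zero => simp
  | succ n ih =>
    have h : 1 - s + n ≠ 0 := fun h => hs (n + 1) (by push_cast; linear_combination -h)
    rw [Finset.prod_range_succ, Nat.cast_succ, ← add_assoc, Complex.Gamma_add_one _ h, ih]
    ring

theorem Gamma_ne_zero_of_ne_intCast {s : ℂ} (hs : ∀ n : ℤ, s ≠ n) : Complex.Gamma s ≠ 0 :=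
  Complex.Gamma_ne_zero fun m h => hs (-m) (by simpa using h)

/-- The Gamma factors of `Δ₃` amount to a rational function times the completed sums. -/
theorem Delta3_eq_gaussXi_div {m : ℕ} (hm : 1 ≤ m) {s : ℂ} (hs : ∀ n : ℤ, s ≠ n) :
    AngularLattice.Delta3 m s =
      gaussXi m s / (s * (s - 1) * ∏ i ∈ Finset.range (2 * m), ((i : ℂ) + 1 - s)) := by
  have hm0 : m ≠ 0 := by omega
  have h0 : s ≠ 0 := by simpa using hs 0
  have h1 : s ≠ 1 := by simpa using hs 1
  have h1' : s - 1 ≠ 0 := sub_ne_zero.2 h1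
  have hpi : (Real.pi : ℂ) ≠ 0 := by exact_mod_cast Real.pi_ne_zero
  have hps : (Real.pi : ℂ) ^ s ≠ 0 := by simp [Complex.cpow_eq_zero_iff, hpi]
  have g0 := Gamma_ne_zero_of_ne_intCast hs
  have g1 : Complex.Gamma (s + 2 * m) ≠ 0 := Gamma_ne_zero_of_ne_intCast fun n h =>
    hs (n - 2 * m) (by push_cast; linear_combination h)
  have g2 : Complex.Gamma (1 - s) ≠ 0 := Gamma_ne_zero_of_ne_intCast fun n h =>
    hs (1 - n) (by push_cast; linear_combination -h)
  have hprod : ∏ i ∈ Finset.range (2 * m), ((i : ℂ) + 1 - s) ≠ 0 :=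
    Finset.prod_ne_zero_iff.2 fun i _ h => hs (i + 1) (by push_cast; linear_combination -h)
  have e1 : (Real.pi : ℂ) ^ (s + 2 * m) = (Real.pi : ℂ) ^ s * (Real.pi : ℂ) ^ (2 * m) := by
    rw [Complex.cpow_add _ _ hpi, ← Complex.cpow_natCast _ (2 * m)]; push_cast; rfl
  have e2 : (Real.pi : ℂ) ^ (2 * s) = (Real.pi : ℂ) ^ s * (Real.pi : ℂ) ^ s := by
    rw [two_mul, Complex.cpow_add _ _ hpi]
  have e3 : Complex.Gamma (1 - s + 2 * m) =
      (∏ i ∈ Finset.range (2 * m), ((i : ℂ) + 1 - s)) * Complex.Gamma (1 - s) := by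
    rw [← Gamma_one_sub_add_natCast hs]; push_cast; rfl
  have hL := gaussPair_zero_Λ h0 h1
  rw [AngularLattice.Delta3_eq, AngularLattice.phaseFactor, latticeC_zero_one h0 h1,
    latticeC_eq m (Or.inl hm0), gaussPair_Λ_eq_Λ₀ hm0, gaussXi, ← hL, e1, e2, e3]
  field_simp

/-! ### The consequences of the Riemann hypothesis for `Δ₃` -/

theorem isClosedEmbedding_intCast_complex : IsClosedEmbedding ((↑) : ℤ → ℂ) := by
  refine Metric.isClosedEmbedding_of_pairwise_le_dist zero_lt_one fun m n h => ?_
  change (1 : ℝ) ≤ dist (m : ℂ) n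
  rw [dist_eq_norm, ← Int.cast_sub, Complex.norm_intCast]
  exact_mod_cast Int.one_le_abs (sub_ne_zero.2 h)

theorem eventually_nhdsNE_ne_intCast (s : ℂ) : ∀ᶠ z : ℂ in 𝓝[≠] s, ∀ n : ℤ, z ≠ n := by
  have hc := isClosedEmbedding_intCast_complex.isClosedMap {n : ℤ | (n : ℂ) ≠ s}
    (isClosed_discrete _)
  have hs : s ∈ (((↑) : ℤ → ℂ) '' {n : ℤ | (n : ℂ) ≠ s})ᶜ := by
    rintro ⟨n, hn, h⟩
    exact hn h
  rw [eventually_nhdsWithin_iff]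
  filter_upwards [hc.isOpen_compl.mem_nhds hs] with z hz hzs n hn
  exact hz ⟨n, fun h => hzs (by rw [Set.mem_singleton_iff, hn, h]), hn.symm⟩

theorem eventually_nhds_ne_intCast {s : ℂ} (hs : ∀ n : ℤ, s ≠ n) :
    ∀ᶠ z : ℂ in 𝓝 s, ∀ n : ℤ, z ≠ n := by
  filter_upwards [eventually_nhdsWithin_iff.1 (eventually_nhdsNE_ne_intCast s)] with z hz
  by_cases h : z = s
  · rwa [h]
  · exact hz h

theorem meromorphicOrderAt_pos_of_eventuallyEq {F h : ℂ → ℂ} {s : ℂ} (hFh : F =ᶠ[𝓝[≠] s] h)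
    (hh : DifferentiableAt ℂ h s) (hm : MeromorphicAt h s) (h0 : h s = 0) :
    0 < meromorphicOrderAt F s := by
  rw [meromorphicOrderAt_congr hFh, ← tendsto_zero_iff_meromorphicOrderAt_pos hm, ← h0]
  exact hh.continuousAt.tendsto.mono_left nhdsWithin_le_nhds

/-- Under the Riemann hypothesis, `Δ₃` is the quotient of a symmetric entire function with zeros
only on the critical line and of an explicit polynomial. The exponent `e` vanishes in the case that
the completed sum of degree `4 m` has zeros at `0` and `1`: the hypothesis does not exclude these,
as they are hidden by the poles, but then they cancel `s (s - 1)`. -/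
theorem exists_symmetric_entire_of_riemannHypothesis {m : ℕ} (hm : 1 ≤ m)
    (hRH : AngularLattice.RiemannHypothesisFor (AngularLattice.Delta3 m)) :
    ∃ (e : ℕ) (E : ℂ → ℂ), Differentiable ℂ E ∧ HasExpGrowth (3 / 2) E ∧
      (∀ s, E (1 - s) = E s) ∧ (∀ s, E s = 0 → s.re = 1 / 2) ∧
      ∀ s : ℂ, (∀ n : ℤ, s ≠ n) → AngularLattice.Delta3 m s =
        E s / ((s * (s - 1)) ^ e * ∏ i ∈ Finset.range (2 * m), ((i : ℂ) + 1 - s)) := by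
  -- it is enough to rule out zeros in the half-plane `Re s < 1/2`
  have key : ∀ (e : ℕ) (E : ℂ → ℂ), Differentiable ℂ E → (∀ s, E (1 - s) = E s) →
      (∀ s : ℂ, (∀ n : ℤ, s ≠ n) → AngularLattice.Delta3 m s =
        E s / ((s * (s - 1)) ^ e * ∏ i ∈ Finset.range (2 * m), ((i : ℂ) + 1 - s))) →
      (e = 0 ∨ E 0 ≠ 0) → ∀ s, E s = 0 → s.re = 1 / 2 := by
    intro e E hE hsymm hform he
    have hleft : ∀ s : ℂ, s.re < 1 / 2 → E s ≠ 0 := by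
      intro s hs hs0
      have hq : (s * (s - 1)) ^ e * ∏ i ∈ Finset.range (2 * m), ((i : ℂ) + 1 - s) ≠ 0 := by
        refine mul_ne_zero ?_ (Finset.prod_ne_zero_iff.2 fun i _ h => ?_)
        · rcases he with rfl | he
          · simp
          · refine pow_ne_zero _ (mul_ne_zero ?_ ?_)
            · rintro rfl; exact he hs0
            · intro h
              have := congrArg Complex.re h
              simp at this; linarith
        · have := congrArg Complex.re h
          simp at this
          have hi : (0 : ℝ) ≤ i := Nat.cast_nonneg i
          linarith
      have hd : Differentiable ℂ fun s : ℂ =>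
          (s * (s - 1)) ^ e * ∏ i ∈ Finset.range (2 * m), ((i : ℂ) + 1 - s) := by fun_prop
      have hpos := meromorphicOrderAt_pos_of_eventuallyEq (F := AngularLattice.Delta3 m)
        (h := fun s => E s / ((s * (s - 1)) ^ e * ∏ i ∈ Finset.range (2 * m), ((i : ℂ) + 1 - s)))
        (s := s) ((eventually_nhdsNE_ne_intCast s).mono fun z hz => hform z hz)
        ((hE s).div (hd s) hq)
        ((hE.analyticAt s).meromorphicAt.div (hd.analyticAt s).meromorphicAt)
        (by simp only [hs0, zero_div])
      exact hs.ne (hRH s hpos)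
    intro s hs0
    by_contra hne
    rcases lt_or_gt_of_ne hne with h | h
    · exact hleft s h hs0
    · exact hleft (1 - s) (by simp; linarith) (by rw [hsymm, hs0])
  have hD := differentiable_gaussXi m
  by_cases h0 : gaussXi m 0 = 0
  · have h1 : gaussXi m 1 = 0 := by rw [← h0, ← gaussXi_one_sub]; simp
    set E₀ := dslope (gaussXi m) 0 with hE₀
    set E := dslope E₀ 1 with hE
    have hE₀d : Differentiable ℂ E₀ := differentiable_dslope hD 0
    have hEd : Differentiable ℂ E := differentiable_dslope hE₀d 1
    have e0 : ∀ s, s * E₀ s = gaussXi m s := fun s => by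
      have := sub_smul_dslope (gaussXi m) 0 s
      simpa [h0] using this
    have hE₀1 : E₀ 1 = 0 := by simpa [h1] using e0 1
    have e1 : ∀ s, s * (s - 1) * E s = gaussXi m s := fun s => by
      have := sub_smul_dslope E₀ 1 s
      rw [hE₀1, sub_zero, smul_eq_mul] at this
      rw [mul_assoc, this, e0]
    have hsymm : ∀ s, E (1 - s) = E s := by
      have hdense : Dense ({0, 1}ᶜ : Set ℂ) := (Set.toFinite _).countable.dense_compl ℂ
      have := Continuous.ext_on hdense (f := fun s => E (1 - s)) (g := E)
        (hEd.continuous.comp (by fun_prop)) hEd.continuous (fun s hs => by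
          simp only [Set.mem_compl_iff, Set.mem_insert_iff, Set.mem_singleton_iff, not_or] at hs
          have hne : s * (s - 1) ≠ 0 := mul_ne_zero hs.1 (sub_ne_zero.2 hs.2)
          refine mul_left_cancel₀ hne ?_
          rw [e1, ← gaussXi_one_sub, ← e1 (1 - s)]
          ring)
      exact fun s => congrFun this s
    have hform : ∀ s : ℂ, (∀ n : ℤ, s ≠ n) → AngularLattice.Delta3 m s =
        E s / ((s * (s - 1)) ^ 0 * ∏ i ∈ Finset.range (2 * m), ((i : ℂ) + 1 - s)) := by
      intro s hs
      have hne : s * (s - 1) ≠ 0 :=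
        mul_ne_zero (by simpa using hs 0) (sub_ne_zero.2 (by simpa using hs 1))
      rw [Delta3_eq_gaussXi_div hm hs, ← e1, mul_div_mul_left _ _ hne, pow_zero, one_mul]
    exact ⟨0, E, hEd, ((hasExpGrowth_gaussXi m).dslope (by norm_num) hD 0).dslope (by norm_num)
      hE₀d 1, hsymm, key 0 E hEd hsymm hform (Or.inl rfl), hform⟩
  · have hform : ∀ s : ℂ, (∀ n : ℤ, s ≠ n) → AngularLattice.Delta3 m s =
        gaussXi m s / ((s * (s - 1)) ^ 1 * ∏ i ∈ Finset.range (2 * m), ((i : ℂ) + 1 - s)) := by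
      intro s hs
      rw [pow_one, Delta3_eq_gaussXi_div hm hs]
    exact ⟨1, gaussXi m, hD, hasExpGrowth_gaussXi m, gaussXi_one_sub m,
      key 1 _ hD (gaussXi_one_sub m) hform (Or.inr h0), hform⟩

/-- The same in the variable `w = t²` for `s = 1/2 + i t`, in which the entire function has order
less than one and nonnegative real zeros. -/
theorem exists_entire_of_riemannHypothesis {m : ℕ} (hm : 1 ≤ m)
    (hRH : AngularLattice.RiemannHypothesisFor (AngularLattice.Delta3 m)) :
    ∃ (e : ℕ) (f : ℂ → ℂ), Differentiable ℂ f ∧ HasExpGrowth (3 / 4) f ∧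
      (∀ z, f z = 0 → 0 ≤ z.re ∧ z.im = 0) ∧
      ∀ s : ℂ, (∀ n : ℤ, s ≠ n) → AngularLattice.Delta3 m s =
        f (-(s - 1 / 2) ^ 2) /
          ((s * (s - 1)) ^ e * ∏ i ∈ Finset.range (2 * m), ((i : ℂ) + 1 - s)) := by
  obtain ⟨e, E, hE, hgrowth, hsymm, hzero, hform⟩ :=
    exists_symmetric_entire_of_riemannHypothesis hm hRH
  set F : ℂ → ℂ := fun t => E (1 / 2 + Complex.I * t) with hF
  have hFd : Differentiable ℂ F := hE.comp (by fun_prop)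
  obtain ⟨f, hf, hfF⟩ := exists_entire_sq_eq hFd fun t => by
    simp only [hF]
    rw [← hsymm]; congr 1; ring
  have hFg : HasExpGrowth (3 / 2) F := by
    have := hgrowth.comp_of_le (g := fun t => 1 / 2 + Complex.I * t) (σ := 1) (K := 3 / 2)
      (by norm_num) (by norm_num) fun t => by
        have := norm_add_le (1 / 2 : ℂ) (Complex.I * t)
        rw [norm_mul, Complex.norm_I, one_mul] at this
        have h2 : ‖(1 / 2 : ℂ)‖ = 1 / 2 := by norm_num
        rw [Real.rpow_one]
        linarith [norm_nonneg t]
    rwa [one_mul] at this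
  refine ⟨e, f, hf, ?_, fun z hz => ?_, fun s hs => ?_⟩
  · have := hFg.of_sq (by norm_num) hfF
    norm_num at this
    exact this
  · have hroot : (z ^ (1 / 2 : ℂ)) ^ 2 = z := by
      rw [← Complex.cpow_nat_mul]; norm_num
    set t := z ^ (1 / 2 : ℂ)
    rw [← hroot, hfF] at hz
    have h1 := hzero _ hz
    have h2 : t.im = 0 := by simpa using h1
    rw [← hroot, pow_two, Complex.mul_re, Complex.mul_im, h2]
    constructor
    · nlinarith [mul_self_nonneg t.re]
    · ring
  · have h1 : -(s - 1 / 2) ^ 2 = (-Complex.I * (s - 1 / 2)) ^ 2 := by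
      rw [mul_pow, neg_sq, Complex.I_sq]; ring
    rw [hform s hs, h1, hfF]
    simp only [hF]
    congr 2
    linear_combination (s - 1 / 2) * Complex.I_sq

/-! ### The derivative of the argument on the critical line -/

theorem critPoint_ne_intCast (t : ℝ) (n : ℤ) : AngularLattice.critPoint t ≠ n := by
  intro h
  have h1 := congrArg Complex.re h
  simp [AngularLattice.critPoint] at h1
  have h2 : (1 : ℝ) = 2 * n := by rw [← h1]; norm_num
  have h3 : (1 : ℤ) = 2 * n := by exact_mod_cast h2
  omega

/-- The derivative of the argument along a horizontal line is the imaginary part of the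
logarithmic derivative. -/
theorem isZeroOfArgDeriv_iff {F : ℂ → ℂ} {σ t : ℝ} (hF : DifferentiableAt ℂ F (σ + t * Complex.I))
    (hev : ∀ᶠ z in 𝓝 ((σ : ℂ) + t * Complex.I), ContinuousAt F z)
    (h0 : F (σ + t * Complex.I) ≠ 0) :
    AngularLattice.IsZeroOfArgDeriv F σ t ↔ (logDeriv F (σ + t * Complex.I)).im = 0 := by
  set s : ℂ := (σ : ℂ) + t * Complex.I with hs
  have hline : HasDerivAt (fun x : ℝ => (x : ℂ) + (t : ℂ) * Complex.I) 1 σ :=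
    (Complex.ofRealCLM.hasDerivAt (x := σ)).add_const _
  have hφ : HasDerivAt (fun x : ℝ => F ((x : ℂ) + (t : ℂ) * Complex.I)) (deriv F s) σ := by
    have := HasDerivAt.comp σ (h₂ := F) hF.hasDerivAt hline
    rw [mul_one] at this
    exact this
  constructor
  · rintro ⟨A, hA, hA'⟩
    have hev : ∀ᶠ x : ℝ in 𝓝 σ, F ((x : ℂ) + (t : ℂ) * Complex.I) =
        (‖F ((x : ℂ) + (t : ℂ) * Complex.I)‖ : ℂ) *
          Complex.exp ((A ((x : ℂ) + (t : ℂ) * Complex.I) : ℂ) * Complex.I) :=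
      (hline.continuousAt.eventually hA).mono fun x hx => hx.2.2
    have hn : DifferentiableAt ℝ (fun x : ℝ => ‖F ((x : ℂ) + (t : ℂ) * Complex.I)‖) σ :=
      hφ.differentiableAt.norm ℝ h0
    have hr := hn.hasDerivAt.ofReal_comp.mul ((hA'.ofReal_comp.mul_const Complex.I).cexp)
    have heq := hφ.unique (hr.congr_of_eventuallyEq hev)
    have hval := hev.self_of_nhds
    set r' := deriv (fun x : ℝ => ‖F ((x : ℂ) + (t : ℂ) * Complex.I)‖) σ
    have hexp := Complex.exp_ne_zero ((A ((σ : ℂ) + (t : ℂ) * Complex.I) : ℂ) * Complex.I)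
    have : logDeriv F s = ((r' / ‖F s‖ : ℝ) : ℂ) := by
      rw [logDeriv_apply, heq]
      simp only [Complex.ofReal_zero, zero_mul, mul_zero, add_zero]
      conv_lhs => rw [hs, hval]
      rw [mul_div_mul_right _ _ hexp, hs]
      push_cast; rfl
    rw [this, Complex.ofReal_im]
  · intro him
    -- the branch `Im log (F z / F s) + arg (F s)`
    have hq : ContinuousAt (fun z => F z / F s) s := hF.continuousAt.div_const _
    have hq1 : F s / F s = 1 := div_self h0
    have hslit : ∀ᶠ z in 𝓝 s, F z / F s ∈ Complex.slitPlane := by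
      refine hq.eventually_mem ?_
      rw [hq1]
      exact Complex.isOpen_slitPlane.mem_nhds Complex.one_mem_slitPlane
    refine ⟨fun z => (Complex.log (F z / F s)).im + (F s).arg, ?_, ?_⟩
    · change ∀ᶠ z in 𝓝 s, _
      filter_upwards [hslit, hev] with z hz hcz
      have hqz : F z / F s ≠ 0 := Complex.slitPlane_ne_zero hz
      have hFz : F z ≠ 0 := fun h => hqz (by rw [h, zero_div])
      refine ⟨hFz, ?_, ?_⟩
      · have : ContinuousAt (fun z => Complex.log (F z / F s)) z :=
          (hcz.div_const _).clog hz
        exact (Complex.continuous_im.continuousAt.comp this).add continuousAt_const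
      · have h1 : F z = F s * Complex.exp (Complex.log (F z / F s)) := by
          rw [Complex.exp_log hqz, mul_div_cancel₀ _ h0]
        have h2 : ‖F z‖ = ‖F s‖ * Real.exp (Complex.log (F z / F s)).re := by
          conv_lhs => rw [h1]
          rw [norm_mul, Complex.norm_exp]
        generalize Complex.log (F z / F s) = L at h1 h2 ⊢
        conv_lhs => rw [h1, ← Complex.norm_mul_exp_arg_mul_I (F s), ← Complex.re_add_im L]
        rw [h2, Complex.exp_add]
        push_cast
        rw [add_mul, Complex.exp_add]
        ring
    · have h1 : HasDerivAt (fun z => Complex.log (F z / F s)) (deriv F s / F s) s := by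
        have := (hF.hasDerivAt.div_const (F s)).clog (by rw [hq1]; exact Complex.one_mem_slitPlane)
        simpa [hq1] using this
      have h2 := HasDerivAt.comp σ h1 hline
      have h3 := (Complex.imCLM.hasFDerivAt.comp_hasDerivAt σ h2).add_const (F s).arg
      refine h3.congr_deriv ?_
      rw [mul_one]
      exact him

/-! ### Monotonicity in the variable `w = t²` -/

/-- The function `-2 w (log f)'(w) + 2 e w / (1/4 + w) + ∑ w / ((i + 1/2)² + w)`. When
`f (t²)` is the entire part of `Δ₃ (1/2 + i t)`, its value at `w = t²` is `t` times the
`σ`-derivative of `arg Δ₃`; it is also `-t (d/dt) log |Δ₃ (1/2 + i t)|`. -/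
noncomputable def radialArgDeriv (f : ℂ → ℂ) (e m : ℕ) (w : ℝ) : ℝ :=
  -2 * ((w : ℂ) * logDeriv f w).re + e * (2 * w / (1 / 4 + w)) +
    ∑ i ∈ Finset.range (2 * m), w / (((i : ℝ) + 1 / 2) ^ 2 + w)

theorem radialArgDeriv_zero (f : ℂ → ℂ) (e m : ℕ) : radialArgDeriv f e m 0 = 0 := by
  simp [radialArgDeriv]

theorem hasDerivAt_div_const_add {a w : ℝ} (h : a + w ≠ 0) :
    HasDerivAt (fun w : ℝ => w / (a + w)) (a / (a + w) ^ 2) w := by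
  refine ((hasDerivAt_id w).div ((hasDerivAt_id w).const_add a) h).congr_deriv ?_
  simp

theorem hasDerivAt_radialArgDeriv {f : ℂ → ℂ} (hf : Differentiable ℂ f) (e m : ℕ) {w : ℝ}
    (hw : 0 ≤ w) (hfw : f w ≠ 0) :
    HasDerivAt (radialArgDeriv f e m)
      (-2 * (logDeriv f w + w * deriv (logDeriv f) w).re + e * (2 * ((1 / 4) / (1 / 4 + w) ^ 2)) +
        ∑ i ∈ Finset.range (2 * m), ((i : ℝ) + 1 / 2) ^ 2 / (((i : ℝ) + 1 / 2) ^ 2 + w) ^ 2) w := by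
  have hl : DifferentiableAt ℂ (logDeriv f) w := (hf.deriv w).div (hf w) hfw
  have h1 : HasDerivAt (fun z : ℂ => z * logDeriv f z)
      (logDeriv f w + w * deriv (logDeriv f) w) w := by
    have := (hasDerivAt_id (w : ℂ)).mul hl.hasDerivAt
    simp only [id_eq, one_mul] at this
    exact this
  have h2 : HasDerivAt (fun w : ℝ => (e : ℝ) * (2 * w / (1 / 4 + w)))
      (e * (2 * ((1 / 4) / (1 / 4 + w) ^ 2))) w := by
    have := ((hasDerivAt_div_const_add (a := 1 / 4) (w := w) (by positivity)).const_mul 2).const_mul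
      (e : ℝ)
    simpa only [mul_div_assoc] using this
  refine ((h1.real_of_complex.const_mul (-2)).add h2).add ?_
  exact HasDerivAt.fun_sum fun i _ => hasDerivAt_div_const_add (by positivity)

theorem strictMonoOn_radialArgDeriv {f : ℂ → ℂ} (hf : Differentiable ℂ f)
    (hg : HasExpGrowth (3 / 4) f) (hz : ∀ z, f z = 0 → 0 ≤ z.re ∧ z.im = 0) (e : ℕ) {m : ℕ}
    (hm : 1 ≤ m) {a b : ℝ} (ha : 0 ≤ a) (hne : ∀ w ∈ Set.Icc a b, f (w : ℂ) ≠ 0) :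
    StrictMonoOn (radialArgDeriv f e m) (Set.Icc a b) := by
  have hd := fun w (hw : w ∈ Set.Icc a b) =>
    hasDerivAt_radialArgDeriv hf e m (ha.trans hw.1) (hne w hw)
  refine strictMonoOn_of_deriv_pos (convex_Icc a b)
    (fun w hw => (hd w hw).continuousAt.continuousWithinAt) fun w hw => ?_
  rw [interior_Icc] at hw
  have hw' := Set.Ioo_subset_Icc_self hw
  have hw0 : 0 < w := ha.trans_lt hw.1
  obtain ⟨C, hC⟩ := hg
  rw [(hd w hw').deriv]
  have h1 := re_deriv_mul_logDeriv_nonpos hf hz (by norm_num) (by norm_num) hC hw0 (hne w hw')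
  have h2 : 0 ≤ (e : ℝ) * (2 * ((1 / 4) / (1 / 4 + w) ^ 2)) := by positivity
  have h3 : 0 < ∑ i ∈ Finset.range (2 * m),
      ((i : ℝ) + 1 / 2) ^ 2 / (((i : ℝ) + 1 / 2) ^ 2 + w) ^ 2 :=
    Finset.sum_pos (fun i _ => by positivity) ⟨0, Finset.mem_range.2 (by omega)⟩
  linarith

theorem critPoint_sub_half (t : ℝ) : AngularLattice.critPoint t - 1 / 2 = t * Complex.I := by
  simp [AngularLattice.critPoint]

theorem neg_sq_critPoint_sub_half (t : ℝ) :
    -(AngularLattice.critPoint t - 1 / 2) ^ 2 = ((t ^ 2 : ℝ) : ℂ) := by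
  rw [critPoint_sub_half, mul_pow, Complex.I_sq]; push_cast; ring

section

variable {m e : ℕ} {f : ℂ → ℂ}

theorem prod_sub_ne_zero {s : ℂ} (hs : ∀ n : ℤ, s ≠ n) :
    (s * (s - 1)) ^ e * ∏ i ∈ Finset.range (2 * m), ((i : ℂ) + 1 - s) ≠ 0 := by
  refine mul_ne_zero (pow_ne_zero _ (mul_ne_zero ?_ ?_)) (Finset.prod_ne_zero_iff.2 fun i _ h => ?_)
  · simpa using hs 0
  · exact sub_ne_zero.2 (by simpa using hs 1)
  · exact hs (i + 1) (by push_cast; linear_combination -h)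

theorem differentiableAt_Delta3 (hf : Differentiable ℂ f)
    (hform : ∀ s : ℂ, (∀ n : ℤ, s ≠ n) → AngularLattice.Delta3 m s = f (-(s - 1 / 2) ^ 2) /
      ((s * (s - 1)) ^ e * ∏ i ∈ Finset.range (2 * m), ((i : ℂ) + 1 - s)))
    {s : ℂ} (hs : ∀ n : ℤ, s ≠ n) : DifferentiableAt ℂ (AngularLattice.Delta3 m) s := by
  have h1 : DifferentiableAt ℂ (fun s : ℂ => f (-(s - 1 / 2) ^ 2)) s :=
    (hf _).comp s (by fun_prop)
  have h2 : DifferentiableAt ℂ (fun s : ℂ =>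
      (s * (s - 1)) ^ e * ∏ i ∈ Finset.range (2 * m), ((i : ℂ) + 1 - s)) s := by fun_prop
  refine (h1.div h2 (prod_sub_ne_zero (m := m) (e := e) hs)).congr_of_eventuallyEq ?_
  filter_upwards [eventually_nhds_ne_intCast hs] with z hz using hform z hz

theorem Delta3_critPoint_ne_zero_iff
    (hform : ∀ s : ℂ, (∀ n : ℤ, s ≠ n) → AngularLattice.Delta3 m s = f (-(s - 1 / 2) ^ 2) /
      ((s * (s - 1)) ^ e * ∏ i ∈ Finset.range (2 * m), ((i : ℂ) + 1 - s))) (t : ℝ) :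
    AngularLattice.Delta3 m (AngularLattice.critPoint t) ≠ 0 ↔ f ((t ^ 2 : ℝ) : ℂ) ≠ 0 := by
  rw [hform _ (critPoint_ne_intCast t), neg_sq_critPoint_sub_half, Ne,
    div_eq_zero_iff, or_iff_left (prod_sub_ne_zero (critPoint_ne_intCast t))]

/-- On the critical line, `t` times the `σ`-derivative of the argument is a function of `t²`. -/
theorem mul_im_logDeriv_Delta3 (hf : Differentiable ℂ f)
    (hform : ∀ s : ℂ, (∀ n : ℤ, s ≠ n) → AngularLattice.Delta3 m s = f (-(s - 1 / 2) ^ 2) /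
      ((s * (s - 1)) ^ e * ∏ i ∈ Finset.range (2 * m), ((i : ℂ) + 1 - s)))
    {t : ℝ} (ht : f ((t ^ 2 : ℝ) : ℂ) ≠ 0) :
    t * (logDeriv (AngularLattice.Delta3 m) (AngularLattice.critPoint t)).im =
      radialArgDeriv f e m (t ^ 2) := by
  have hs := critPoint_ne_intCast t
  have hsub := critPoint_sub_half t
  have hsq := neg_sq_critPoint_sub_half t
  set s := AngularLattice.critPoint t with hsdef
  have hev : AngularLattice.Delta3 m =ᶠ[𝓝 s] fun s => f (-(s - 1 / 2) ^ 2) /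
      ((s * (s - 1)) ^ e * ∏ i ∈ Finset.range (2 * m), ((i : ℂ) + 1 - s)) := by
    filter_upwards [eventually_nhds_ne_intCast hs] with z hz using hform z hz
  have hne := mul_ne_zero_iff.1 (prod_sub_ne_zero (m := m) (e := e) hs)
  have hinner : DifferentiableAt ℂ (fun s : ℂ => -(s - 1 / 2) ^ 2) s := by fun_prop
  have hd1 : DifferentiableAt ℂ (fun s : ℂ => f (-(s - 1 / 2) ^ 2)) s := (hf _).comp s hinner
  have l1 : logDeriv (fun s : ℂ => f (-(s - 1 / 2) ^ 2)) s =
      logDeriv f ((t ^ 2 : ℝ) : ℂ) * (-(2 * (t * Complex.I))) := by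
    have := logDeriv_comp (f := f) (g := fun s : ℂ => -(s - 1 / 2) ^ 2) (x := s) (hf _) hinner
    rw [Function.comp_def] at this
    rw [this, hsq]
    have hd : HasDerivAt (fun s : ℂ => -(s - 1 / 2) ^ 2) (-(2 * (s - 1 / 2))) s := by
      have := (((hasDerivAt_id s).sub_const (1 / 2)).pow 2).neg
      refine this.congr_deriv ?_
      simp
    rw [hd.deriv, hsub]
  have l2 : logDeriv (fun s : ℂ => (s * (s - 1)) ^ e) s =
      e * (2 * (t * Complex.I) / -((1 / 4 + t ^ 2 : ℝ) : ℂ)) := by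
    rw [logDeriv_fun_pow (by fun_prop), logDeriv_apply]
    have hd : HasDerivAt (fun s : ℂ => s * (s - 1)) (2 * (s - 1 / 2)) s := by
      have := (hasDerivAt_id s).mul ((hasDerivAt_id s).sub_const 1)
      refine this.congr_deriv ?_
      simp; ring
    have hv : s * (s - 1) = -((1 / 4 + t ^ 2 : ℝ) : ℂ) := by
      push_cast at hsq ⊢
      linear_combination -hsq
    rw [hd.deriv, hv, hsub]
  have l3 : logDeriv (fun s : ℂ => ∏ i ∈ Finset.range (2 * m), ((i : ℂ) + 1 - s)) s =
      ∑ i ∈ Finset.range (2 * m), -1 / (((i + 1 / 2 : ℝ) : ℂ) - t * Complex.I) := by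
    rw [logDeriv_prod (Finset.prod_ne_zero_iff.1 hne.2) (fun i _ => by fun_prop)]
    refine Finset.sum_congr rfl fun i _ => ?_
    rw [logDeriv_apply]
    have hd : HasDerivAt (fun s : ℂ => (i : ℂ) + 1 - s) (-1) s :=
      (hasDerivAt_id s).const_sub _
    rw [hd.deriv]
    congr 1
    push_cast
    linear_combination -hsub
  have hsum : (∑ i ∈ Finset.range (2 * m), -1 / (((i + 1 / 2 : ℝ) : ℂ) - t * Complex.I)).im =
      -∑ i ∈ Finset.range (2 * m), t / (((i : ℝ) + 1 / 2) ^ 2 + t ^ 2) := by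
    rw [Complex.im_sum, ← Finset.sum_neg_distrib]
    refine Finset.sum_congr rfl fun i _ => ?_
    rw [Complex.div_im, Complex.normSq_apply]
    simp
    ring
  have hL : (logDeriv f ((t ^ 2 : ℝ) : ℂ) * (-(2 * (t * Complex.I)))).im =
      -2 * t * (logDeriv f ((t ^ 2 : ℝ) : ℂ)).re := by
    generalize logDeriv f ((t ^ 2 : ℝ) : ℂ) = L
    simp [Complex.mul_im]
    ring
  have hP : ((e : ℂ) * (2 * (t * Complex.I) / -((1 / 4 + t ^ 2 : ℝ) : ℂ))).im =
      -(e * (2 * t / (1 / 4 + t ^ 2))) := by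
    have : (e : ℂ) * (2 * (t * Complex.I) / -((1 / 4 + t ^ 2 : ℝ) : ℂ)) =
        ((-(e * (2 * t / (1 / 4 + t ^ 2))) : ℝ) : ℂ) * Complex.I := by
      rw [div_neg]; push_cast; ring
    rw [this, Complex.im_ofReal_mul, Complex.I_im, mul_one]
  rw [(logDeriv_congr_nhds hev).eq_of_nhds, logDeriv_div s (by rw [hsq]; exact ht)
    (prod_sub_ne_zero (m := m) (e := e) hs) hd1 (by fun_prop),
    logDeriv_mul (f := fun s : ℂ => (s * (s - 1)) ^ e) s hne.1 hne.2 (by fun_prop) (by fun_prop),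
    l1, l2, l3, Complex.sub_im, Complex.add_im, hsum, hL, hP, radialArgDeriv,
    Complex.re_ofReal_mul]
  have h4 : ∑ i ∈ Finset.range (2 * m), t ^ 2 / (((i : ℝ) + 1 / 2) ^ 2 + t ^ 2) =
      t * ∑ i ∈ Finset.range (2 * m), t / (((i : ℝ) + 1 / 2) ^ 2 + t ^ 2) := by
    rw [Finset.mul_sum]
    exact Finset.sum_congr rfl fun i _ => by ring
  rw [h4]
  ring

end

/-- Between two zeros on a vertical line, `|F|` has a critical point, and by the Cauchy–Riemann
equations the `σ`-derivative of the argument vanishes there. -/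
theorem exists_im_logDeriv_eq_zero {F : ℂ → ℂ}
    (hF : ∀ t : ℝ, DifferentiableAt ℂ F (AngularLattice.critPoint t)) {t₀ t₁ : ℝ} (hlt : t₀ < t₁)
    (h₀ : F (AngularLattice.critPoint t₀) = 0) (h₁ : F (AngularLattice.critPoint t₁) = 0) :
    ∃ t ∈ Set.Ioo t₀ t₁, (logDeriv F (AngularLattice.critPoint t)).im = 0 := by
  have hline : ∀ t : ℝ, HasDerivAt AngularLattice.critPoint Complex.I t := fun t => by
    have := ((Complex.ofRealCLM.hasDerivAt (x := t)).mul_const Complex.I).const_add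
      (((1 / 2 : ℝ) : ℂ))
    refine this.congr_deriv ?_
    simp
  have hφ : ∀ t : ℝ, HasDerivAt (fun t => F (AngularLattice.critPoint t))
      (deriv F (AngularLattice.critPoint t) * Complex.I) t := fun t =>
    HasDerivAt.comp t (h₂ := F) (hF t).hasDerivAt (hline t)
  have hn := fun t => (hφ t).norm_sq
  obtain ⟨t, ht, hd⟩ := exists_hasDerivAt_eq_zero hlt
    (fun t _ => (hn t).continuousAt.continuousWithinAt) (by simp [h₀, h₁]) (fun t _ => hn t)
  refine ⟨t, ht, ?_⟩
  rw [logDeriv_apply, Complex.div_im]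
  generalize F (AngularLattice.critPoint t) = a at hd ⊢
  generalize deriv F (AngularLattice.critPoint t) = b at hd ⊢
  have hab : b.im * a.re - b.re * a.im = 0 := by
    simp [Complex.inner] at hd
    linarith
  rw [← sub_div, hab, zero_div]

open AngularLattice in
theorem theorem5p6 (m : ℕ) (hm : 1 ≤ m) (hRH : RiemannHypothesisFor (Delta3 m))
    (t₀ t₁ : ℝ) (hlt : t₀ < t₁)
    (h₀ : Delta3 m (critPoint t₀) = 0) (h₁ : Delta3 m (critPoint t₁) = 0)
    (hsucc : ∀ t ∈ Set.Ioo t₀ t₁, Delta3 m (critPoint t) ≠ 0) :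
    ∃! t : ℝ, t ∈ Set.Ioo t₀ t₁ ∧ IsZeroOfArgDeriv (Delta3 m) (1 / 2) t := by
  obtain ⟨e, f, hf, hg, hz, hform⟩ := exists_entire_of_riemannHypothesis hm hRH
  have hdiff : ∀ s : ℂ, (∀ n : ℤ, s ≠ n) → DifferentiableAt ℂ (Delta3 m) s := fun s hs =>
    differentiableAt_Delta3 hf hform hs
  have hfne : ∀ t ∈ Set.Ioo t₀ t₁, f ((t ^ 2 : ℝ) : ℂ) ≠ 0 := fun t ht =>
    (Delta3_critPoint_ne_zero_iff hform t).1 (hsucc t ht)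
  have hiff : ∀ t ∈ Set.Ioo t₀ t₁, (IsZeroOfArgDeriv (Delta3 m) (1 / 2) t ↔
      (logDeriv (Delta3 m) (critPoint t)).im = 0) := fun t ht =>
    isZeroOfArgDeriv_iff (hdiff _ (critPoint_ne_intCast t))
      ((eventually_nhds_ne_intCast (critPoint_ne_intCast t)).mono fun z hz =>
        (hdiff z hz).continuousAt) (hsucc t ht)
  have hradial : ∀ t ∈ Set.Ioo t₀ t₁, IsZeroOfArgDeriv (Delta3 m) (1 / 2) t →
      radialArgDeriv f e m (t ^ 2) = 0 := fun t ht h => by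
    rw [← mul_im_logDeriv_Delta3 hf hform (hfne t ht), (hiff t ht).1 h, mul_zero]
  -- `radialArgDeriv` cannot vanish twice on the squares of an interval of one sign
  have hmono : ∀ a b : ℝ, 0 ≤ a → a < b →
      (∀ u ∈ Set.Icc a b, f ((u ^ 2 : ℝ) : ℂ) ≠ 0) → radialArgDeriv f e m (a ^ 2) = 0 →
      radialArgDeriv f e m (b ^ 2) = 0 → False := by
    intro a b ha hab hne ha0 hb0
    have hsq : a ^ 2 < b ^ 2 := by nlinarith
    have hmon := strictMonoOn_radialArgDeriv hf hg hz e hm (sq_nonneg a) (b := b ^ 2)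
      fun w hw => by
        have hw0 : 0 ≤ w := (sq_nonneg a).trans hw.1
        have := hne (Real.sqrt w) ⟨Real.le_sqrt_of_sq_le hw.1,
          Real.sqrt_le_iff.2 ⟨by linarith, hw.2⟩⟩
        rwa [Real.sq_sqrt hw0] at this
    have := hmon (Set.left_mem_Icc.2 hsq.le) (Set.right_mem_Icc.2 hsq.le) hsq
    rw [ha0, hb0] at this
    exact lt_irrefl _ this
  have huniq : ∀ a ∈ Set.Ioo t₀ t₁, ∀ b ∈ Set.Ioo t₀ t₁,
      IsZeroOfArgDeriv (Delta3 m) (1 / 2) a → IsZeroOfArgDeriv (Delta3 m) (1 / 2) b → ¬ a < b := by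
    intro a ha b hb hza hzb hab
    have ha0 := hradial a ha hza
    have hb0 := hradial b hb hzb
    rcases le_or_gt b 0 with h | h
    · refine hmono (-b) (-a) (by linarith) (by linarith) (fun u hu => ?_) (by rwa [neg_sq])
        (by rwa [neg_sq])
      have := hfne (-u) ⟨by linarith [hu.2, ha.1], by linarith [hu.1, hb.2]⟩
      rwa [neg_sq] at this
    · -- if `a ≤ 0 < b`, the value at `a` is replaced by the zero of `radialArgDeriv` at `0`
      refine hmono (max a 0) b (le_max_right _ _) (max_lt hab h) (fun u hu => ?_) ?_ hb0
      · exact hfne u ⟨ha.1.trans_le ((le_max_left _ _).trans hu.1), hu.2.trans_lt hb.2⟩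
      · rcases max_cases a 0 with ⟨h', _⟩ | ⟨h', _⟩ <;> rw [h']
        · exact ha0
        · rw [zero_pow two_ne_zero, radialArgDeriv_zero]
  obtain ⟨t, ht, him⟩ := exists_im_logDeriv_eq_zero
    (fun t => hdiff _ (critPoint_ne_intCast t)) hlt h₀ h₁
  have hzt := (hiff t ht).2 him
  refine ⟨t, ⟨ht, hzt⟩, fun u hu => ?_⟩
  rcases lt_trichotomy u t with h | h | h
  · exact absurd h (huniq u hu.1 t ht hu.2 hzt)
  · exact h
  · exact absurd h (huniq t ht u hu.1 hzt hu.2)
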